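/- Let $G$ be a discrete group for which the orders of the finite subgroups are bounded, and let $\Delta^+\le G$ be the largest finite normal subgroup of $G$. Let $K\subset\mathbb C$ be a subfield closed under complex conjugation. The group ring $\mathbb C[G]$ acts on $\ell^2(G)$ by left convolution; let $\mathcal N(G)$ be the group von Neumann algebra it generates, and let $\mathrm{tr}^u\colon\mathcal N(G)\to Z(\mathcal N(G))$ be the center-valued trace, i.e. the unique $\mathbb C$-linear map with $\mathrm{tr}^u(ab)=\mathrm{tr}^u(ba)$ for $a,b\in\mathcal N(G)$, $\mathrm{tr}^u(c)=c$ for $c\in Z(\mathcal N(G))$, and $\mathrm{tr}^u(a)\ge 0$ for $a\ge 0$. For a closed right $G$-invariant subspace $V\subset\ell^2(G)$ let $\dim_{\mathcal N(G)}(V)=\langle \mathrm{pr}_V\delta_e,\delta_e\rangle$. A projection is a self-adjoint idempotent. Let $P^1,\dots,P^C$ be the distinct elements of $\mathbb C[G]$ of the form $\sum_{q} q$, where the sum runs over the distinct $G$-conjugates $q=gpg^{-1}$ $(g\in G)$ of a primitive central idempotent $p$ of $K[\Delta^+]$. Let $H$ be a finite subgroup of $G$ containing $\Delta^+$, and let $Q\in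 K[H]$ be an irreducible projection, i.e. a nonzero projection such that whenever $Q=Q_1+Q_2$ with projections $Q_1,Q_2\in K[H]$ and $Q_1Q_2=0$, then $Q_1=0$ or $Q_2=0$. Then $\mathrm{tr}^u(Q)\in Z(\mathcal N(G))\cap Z(K[\Delta^+])$; there is exactly one $P\in\{P^1,\dots,P^C\}$ with $QP=Q$; this $P$ is a projection and a primitive idempotent of $Z(\mathcal N(G))\cap Z(K[\Delta^+])$; and $$\mathrm{tr}^u(Q)=\frac{\dim_{\mathbb C}(Q\cdot\mathbb C[H])\cdot|\Delta^+|}{|H|\cdot\dim_{\mathbb C}(P\cdot\mathbb C[\Delta^+])}\,P=\frac{\dim_{\mathcal N(G)}(Q\cdot\ell^2(G))}{\dim_{\mathcal N(G)}(P\cdot\ell^2(G))}\,P .$$ In particular $\mathrm{tr}^u(Q)$ is a rational multiple of $P$. -/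

import Mathlib

noncomputable section

namespace GroupVN

/-- The Hilbert space `ℓ²(G)` of square-summable functions `G → ℂ`. -/
abbrev L2 (G : Type*) := lp (fun _ : G => ℂ) 2

/-- The unitary of `ℓ²(X)` induced by a permutation `σ`: `(permute σ f) x = f (σ⁻¹ x)`. -/
def permute {X : Type*} (σ : Equiv.Perm X) : L2 X →ₗᵢ[ℂ] L2 X where
  toFun f := ⟨fun x => f (σ.symm x), by
    have h := lp.memℓp f
    change Memℓp (fun x => f (σ.symm x)) 2
    rw [memℓp_gen_iff (by norm_num)] at h ⊢
    exact (σ.symm.summable_iff (f := fun x => ‖f x‖ ^ (2 : ENNReal).toReal)).2 h⟩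
  map_add' f g := by ext x; rfl
  map_smul' c f := by ext x; rfl
  norm_map' f := by
    have h2 : 0 < (2 : ENNReal).toReal := by norm_num
    rw [lp.norm_eq_tsum_rpow h2, lp.norm_eq_tsum_rpow h2]
    congr 1
    exact σ.symm.tsum_eq (fun x => ‖f x‖ ^ (2 : ENNReal).toReal)

theorem permute_apply {X : Type*} (σ : Equiv.Perm X) (f : L2 X) (x : X) :
    permute σ f x = f (σ.symm x) := rfl

variable {G : Type*} [Group G]

open scoped Classical in
/-- The standard basis vector `δ_x` of `ℓ²(G)`. -/
def delta {G : Type*} (x : G) : L2 G := lp.single 2 x (1 : ℂ)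

variable (G) in
/-- The left regular representation `(λ_g f)(x) = f (g⁻¹ x)` of `G` on `ℓ²(G)`. -/
def leftRegular : G →* (L2 G →L[ℂ] L2 G) where
  toFun g := (permute (Equiv.mulLeft g)).toContinuousLinearMap
  map_one' := by
    ext f x
    change f ((1 : G)⁻¹ * x) = f x
    simp
  map_mul' g h := by
    ext f x
    change f ((g * h)⁻¹ * x) = f (h⁻¹ * (g⁻¹ * x))
    simp [mul_assoc]

theorem leftRegular_apply (g : G) (f : L2 G) (x : G) : leftRegular G g f x = f (g⁻¹ * x) := rfl

open scoped Classical in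
theorem delta_apply {G : Type*} (x y : G) :
    delta x y = if y = x then 1 else 0 := by
  unfold delta
  split_ifs with h
  · subst h; simp
  · exact lp.single_apply_ne (E := fun _ : G => ℂ) 2 x (1 : ℂ) h

theorem inner_delta {G : Type*} (x : G) (f : L2 G) : inner ℂ (delta x) f = f x := by
  classical
  unfold delta
  rw [lp.inner_single_left]; simp

theorem permute_delta {X : Type*} (σ : Equiv.Perm X) (x : X) : permute σ (delta x) = delta (σ x) := by
  classical
  ext y
  simp [permute_apply, delta_apply, Equiv.symm_apply_eq]

theorem leftRegular_delta (g x : G) : leftRegular G g (delta x) = delta (g * x) :=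
  permute_delta _ _

variable (G) in
/-- The group von Neumann algebra `𝓝(G)`: the double commutant of the left regular
representation. -/
def groupVN : VonNeumannAlgebra (L2 G) where
  toStarSubalgebra := StarSubalgebra.centralizer ℂ
    (StarSubalgebra.centralizer ℂ (Set.range (leftRegular G)) : Set (L2 G →L[ℂ] L2 G))
  centralizer_centralizer' := by
    change Set.centralizer (Set.centralizer ((StarSubalgebra.centralizer ℂ
      (StarSubalgebra.centralizer ℂ (Set.range (leftRegular G)) : Set (L2 G →L[ℂ] L2 G)) :
      StarSubalgebra ℂ _) : Set (L2 G →L[ℂ] L2 G))) = ((StarSubalgebra.centralizer ℂ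
      (StarSubalgebra.centralizer ℂ (Set.range (leftRegular G)) : Set (L2 G →L[ℂ] L2 G)) :
      StarSubalgebra ℂ _) : Set (L2 G →L[ℂ] L2 G))
    rw [StarSubalgebra.coe_centralizer_centralizer, Set.centralizer_centralizer_centralizer]

variable (G) in
/-- `𝓝(G)` as a `*`-algebra. -/
abbrev NG : StarSubalgebra ℂ (L2 G →L[ℂ] L2 G) := (groupVN G).toStarSubalgebra

theorem star_leftRegular (g : G) : star (leftRegular G g) = leftRegular G g⁻¹ := by
  rw [ContinuousLinearMap.star_eq_adjoint, eq_comm, ContinuousLinearMap.eq_adjoint_iff]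
  intro x y
  have h := (permute (Equiv.mulLeft g)).inner_map_map (leftRegular G g⁻¹ x) y
  rw [← h]
  congr 1
  ext z
  simp [permute_apply, leftRegular_apply]

theorem mem_NG_iff {T : L2 G →L[ℂ] L2 G} :
    T ∈ NG G ↔ ∀ S : L2 G →L[ℂ] L2 G, (∀ g, leftRegular G g * S = S * leftRegular G g) →
      S * T = T * S := by
  have : T ∈ NG G ↔ T ∈ (Set.range (leftRegular G) ∪ star (Set.range (leftRegular G))).centralizer.centralizer := by
    rw [← StarSubalgebra.coe_centralizer_centralizer (R := ℂ)]; rfl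
  have h2 : star (Set.range (leftRegular G)) = Set.range (leftRegular G) := by
    ext S
    constructor
    · rintro ⟨g, hg⟩
      exact ⟨g⁻¹, by rw [← star_leftRegular, hg, star_star]⟩
    · rintro ⟨g, rfl⟩
      exact ⟨g⁻¹, by rw [star_leftRegular]⟩
  rw [this, h2, Set.union_self, Set.mem_centralizer_iff]
  refine forall_congr' fun S => ?_
  rw [Set.mem_centralizer_iff, Set.forall_mem_range]

variable (G) in
/-- The inclusion `G → 𝓝(G)`. -/
def leftRegularNG : G →* NG G where
  toFun g := ⟨leftRegular G g, mem_NG_iff.2 fun _ hS => (hS g).symm⟩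
  map_one' := Subtype.ext (map_one _)
  map_mul' g h := Subtype.ext (map_mul _ g h)

variable (G) in
/-- The inclusion `ℂ[G] → 𝓝(G)`: an element of the group ring acts on `ℓ²(G)` by left
convolution. -/
def groupRingToNG : MonoidAlgebra ℂ G →ₐ[ℂ] NG G :=
  MonoidAlgebra.lift ℂ (NG G) G (leftRegularNG G)

/-! ### The centre-valued trace -/

/-- The Fourier coefficients `g ↦ (T δ_e)(g)` of an operator `T` on `ℓ²(G)`, i.e. the image of `T`
under the standard embedding of `𝓝(G)` into functions on `G`. -/
def fourier (T : L2 G →L[ℂ] L2 G) (g : G) : ℂ := T (delta 1) g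

open scoped Classical in
/-- The average of `f` over the conjugacy class of `g` if that class is finite, and `0` otherwise.
On `ℓ²(G)` this is the orthogonal projection onto the functions that are constant on conjugacy
classes. -/
def classAverage (f : G → ℂ) (g : G) : ℂ :=
  if (conjugatesOf g).Finite then (∑ᶠ x ∈ conjugatesOf g, f x) / (conjugatesOf g).ncard else 0

/-- The right translation `(f ↦ f (· x⁻¹))`, which commutes with `𝓝(G)`. -/
def rightReg (x : G) : L2 G →L[ℂ] L2 G :=
  (permute (Equiv.mulRight x)).toContinuousLinearMap

theorem rightReg_apply (g : G) (f : L2 G) (x : G) : rightReg g f x = f (x * g⁻¹) := rfl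

theorem rightReg_delta (g x : G) : rightReg g (delta x) = delta (x * g) :=
  permute_delta _ _

theorem NG_rightReg (T : NG G) (x : G) (f : L2 G) :
    rightReg x ((T : L2 G →L[ℂ] L2 G) f) = (T : L2 G →L[ℂ] L2 G) (rightReg x f) := by
  have := mem_NG_iff.1 T.2 (rightReg x) (fun g => by
    ext f y; simp [rightReg_apply, leftRegular_apply, mul_assoc])
  exact congrArg (fun S => S f) this

theorem NG_delta (T : NG G) (x y : G) :
    (T : L2 G →L[ℂ] L2 G) (delta x) y = fourier (T : L2 G →L[ℂ] L2 G) (y * x⁻¹) := by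
  have := NG_rightReg T x (delta 1)
  rw [rightReg_delta, one_mul] at this
  rw [← this, rightReg_apply]; rfl

theorem dense_span_delta {G : Type*} : Dense ((Submodule.span ℂ (Set.range (delta : G → L2 G)) : Submodule ℂ (L2 G)) : Set (L2 G)) := by
  classical
  intro f
  have h := lp.hasSum_single (p := 2) (by norm_num) f
  refine mem_closure_of_tendsto h (Filter.Eventually.of_forall fun s => ?_)
  refine Submodule.sum_mem _ fun i _ => ?_
  have : lp.single 2 i (f i) = (f i) • (delta i : L2 G) := by
    unfold delta
    rw [← lp.single_smul]; simp
  rw [this]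
  exact Submodule.smul_mem _ _ (Submodule.subset_span ⟨i, rfl⟩)

theorem ext_delta {G : Type*} {S T : L2 G →L[ℂ] L2 G} (h : ∀ x, S (delta x) = T (delta x)) : S = T :=
  ContinuousLinearMap.ext_on dense_span_delta (by rintro _ ⟨x, rfl⟩; exact h x)

theorem fourier_injective {S T : NG G} (h : ∀ g, fourier (S : L2 G →L[ℂ] L2 G) g = fourier (T : L2 G →L[ℂ] L2 G) g) : S = T := by
  refine Subtype.ext (ext_delta fun x => ?_)
  ext y
  rw [NG_delta, NG_delta, h]

theorem mem_NG_of_tendsto {u : ℕ → NG G} {T : L2 G →L[ℂ] L2 G}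
    (h : ∀ f, Filter.Tendsto (fun n => (u n : L2 G →L[ℂ] L2 G) f) Filter.atTop (nhds (T f))) :
    T ∈ NG G := by
  refine mem_NG_iff.2 fun S hS => ?_
  ext1 f
  have h1 : Filter.Tendsto (fun n => (u n : L2 G →L[ℂ] L2 G) (S f)) Filter.atTop (nhds (S (T f))) := by
    have h2 := (S.continuous.tendsto _).comp (h f)
    refine h2.congr fun n => ?_
    exact congrArg (fun R => R f) (mem_NG_iff.1 (u n).2 S hS)
  exact tendsto_nhds_unique h1 (h (S f))

theorem exists_limit {u : ℕ → NG G} {C : ℝ} (hC : ∀ n, ‖(u n : L2 G →L[ℂ] L2 G)‖ ≤ C)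
    {η : L2 G} (h : Filter.Tendsto (fun n => (u n : L2 G →L[ℂ] L2 G) (delta 1)) Filter.atTop (nhds η)) :
    ∃ T : NG G, ∀ f, Filter.Tendsto (fun n => (u n : L2 G →L[ℂ] L2 G) f) Filter.atTop
      (nhds ((T : L2 G →L[ℂ] L2 G) f)) := by
  have hC0 : 0 ≤ C := (norm_nonneg _).trans (hC 0)
  have hspan : ∀ f ∈ Submodule.span ℂ (Set.range (delta : G → L2 G)),
      ∃ y, Filter.Tendsto (fun n => (u n : L2 G →L[ℂ] L2 G) f) Filter.atTop (nhds y) := by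
    intro f hf
    induction hf using Submodule.span_induction with
    | mem f hf =>
      obtain ⟨x, rfl⟩ := hf
      refine ⟨rightReg x η, ?_⟩
      have h2 := ((rightReg x).continuous.tendsto _).comp h
      refine h2.congr fun n => ?_
      simp [NG_rightReg, rightReg_delta]
    | zero => exact ⟨0, by simp⟩
    | add f g _ _ hf hg =>
      obtain ⟨y, hy⟩ := hf
      obtain ⟨z, hz⟩ := hg
      exact ⟨y + z, by simpa using hy.add hz⟩
    | smul c f _ hf =>
      obtain ⟨y, hy⟩ := hf
      exact ⟨c • y, by simpa using hy.const_smul c⟩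
  have hall : ∀ f, ∃ y, Filter.Tendsto (fun n => (u n : L2 G →L[ℂ] L2 G) f) Filter.atTop (nhds y) := by
    intro f
    refine cauchySeq_tendsto_of_complete ?_
    rw [Metric.cauchySeq_iff']
    intro ε hε
    have hpos : 0 < ε / (4 * (C + 1)) := by positivity
    obtain ⟨f', hf', hd⟩ := Metric.dense_iff.1 dense_span_delta f _ hpos
    obtain ⟨y, hy⟩ := hspan f' hd
    obtain ⟨N, hN⟩ := Metric.cauchySeq_iff'.1 hy.cauchySeq (ε / 2) (by positivity)
    refine ⟨N, fun n hn => ?_⟩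
    have hb : ∀ m, dist ((u m : L2 G →L[ℂ] L2 G) f) ((u m : L2 G →L[ℂ] L2 G) f') < ε / 4 := by
      intro m
      rw [dist_eq_norm, ← map_sub]
      refine ((u m : L2 G →L[ℂ] L2 G).le_opNorm _).trans_lt ?_
      rw [Metric.mem_ball, dist_eq_norm, norm_sub_rev, lt_div_iff₀ (by positivity)] at hf'
      have := mul_le_mul_of_nonneg_right (hC m) (norm_nonneg (f - f'))
      nlinarith [norm_nonneg (f - f')]
    have h1 := hb n
    have h2 := hb N
    have h3 := hN n hn
    rw [dist_comm] at h2
    linarith [dist_triangle4 ((u n : L2 G →L[ℂ] L2 G) f) ((u n : L2 G →L[ℂ] L2 G) f') ((u N : L2 G →L[ℂ] L2 G) f') ((u N : L2 G →L[ℂ] L2 G) f)]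
  choose F hF using hall
  let T := continuousLinearMapOfTendsto (fun n => (u n : L2 G →L[ℂ] L2 G)) (tendsto_pi_nhds.2 hF)
  exact ⟨⟨T, mem_NG_of_tendsto (u := u) hF⟩, hF⟩

/-- A nonempty closed convex subset of a Hilbert space has a unique element of minimal norm. -/
theorem exists_min_norm {E : Type*} [NormedAddCommGroup E] [InnerProductSpace ℂ E] [CompleteSpace E]
    {K : Set E} (hne : K.Nonempty) (hcl : IsClosed K)
    (hconv : ∀ x ∈ K, ∀ y ∈ K, ∀ a b : ℝ, 0 ≤ a → 0 ≤ b → a + b = 1 → (a : ℂ) • x + (b : ℂ) • y ∈ K) :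
    ∃ v ∈ K, ∀ w ∈ K, ‖w‖ ≤ ‖v‖ → w = v := by
  let _ : InnerProductSpace ℝ E := InnerProductSpace.rclikeToReal ℂ E
  have hK : Convex ℝ K := by
    intro x hx y hy a b ha hb hab
    exact hconv x hx y hy a b ha hb hab
  obtain ⟨v, hv, hmin⟩ := exists_norm_eq_iInf_of_complete_convex hne hcl.isComplete hK 0
  have hle : ∀ w ∈ K, ‖v‖ ≤ ‖w‖ := by
    intro w hw
    have : (⨅ w : K, ‖0 - (w : E)‖) ≤ ‖0 - w‖ :=
      ciInf_le ⟨0, by rintro _ ⟨z, rfl⟩; exact norm_nonneg _⟩ (⟨w, hw⟩ : K)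
    rw [← hmin] at this
    simpa using this
  refine ⟨v, hv, fun w hw hwv => ?_⟩
  have h1 := hle _ (hconv v hv w hw (1/2) (1/2) (by norm_num) (by norm_num) (by norm_num))
  have h2 := parallelogram_law_with_norm ℂ v w
  have h3 : ((1/2 : ℝ) : ℂ) • v + ((1/2 : ℝ) : ℂ) • w = ((1/2 : ℝ) : ℂ) • (v + w) := by rw [smul_add]
  rw [h3, norm_smul] at h1
  have h4 : ‖((1/2 : ℝ) : ℂ)‖ = 1/2 := by
    rw [Complex.norm_real]; norm_num
  rw [h4] at h1
  have h5 : ‖v - w‖ = 0 := by nlinarith [norm_nonneg v, norm_nonneg w, norm_nonneg (v - w), norm_nonneg (v + w)]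
  exact (sub_eq_zero.1 (norm_eq_zero.1 h5)).symm

theorem classAverage_of_finite {g : G} (hg : (conjugatesOf g).Finite) (f : G → ℂ) :
    classAverage f g = (∑ x ∈ hg.toFinset, f x) / (conjugatesOf g).ncard := by
  rw [classAverage, if_pos hg, finsum_mem_eq_finite_toFinset_sum f hg]

theorem classAverage_of_infinite {g : G} (hg : ¬ (conjugatesOf g).Finite) (f : G → ℂ) :
    classAverage f g = 0 := by
  rw [classAverage, if_neg hg]

theorem classAverage_linear (c d : ℂ) (f f' : G → ℂ) (g : G) :
    classAverage (fun x => c * f x + d * f' x) g = c * classAverage f g + d * classAverage f' g := by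
  by_cases hg : (conjugatesOf g).Finite
  · simp only [classAverage_of_finite hg, Finset.sum_add_distrib, ← Finset.mul_sum]
    ring
  · simp [classAverage_of_infinite hg]

theorem classAverage_conj (h : G) (f : G → ℂ) (g : G) :
    classAverage (fun x => f (h⁻¹ * x * h)) g = classAverage f g := by
  by_cases hg : (conjugatesOf g).Finite
  · simp only [classAverage_of_finite hg]
    congr 1
    refine Finset.sum_bij' (fun x _ => h⁻¹ * x * h) (fun x _ => h * x * h⁻¹) ?_ ?_ ?_ ?_ ?_
    · intro x hx
      rw [Set.Finite.mem_toFinset] at hx ⊢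
      exact IsConj.trans (b := x) hx (isConj_iff.2 ⟨h⁻¹, by group⟩)
    · intro x hx
      rw [Set.Finite.mem_toFinset] at hx ⊢
      exact IsConj.trans (b := x) hx (isConj_iff.2 ⟨h, by group⟩)
    · intro x _; group
    · intro x _; group
    · intro x _; rfl
  · simp [classAverage_of_infinite hg]

theorem classAverage_eq_self {f : L2 G} (hf : ∀ h x, f (h⁻¹ * x * h) = f x) (g : G) :
    classAverage f g = f g := by
  have hc : ∀ x ∈ conjugatesOf g, f x = f g := by
    intro x hx
    obtain ⟨c, rfl⟩ := isConj_iff.1 hx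
    rw [← hf c]
    group
  by_cases hg : (conjugatesOf g).Finite
  · rw [classAverage_of_finite hg, Finset.sum_congr rfl (fun x hx => hc x (hg.mem_toFinset.1 hx)),
      Finset.sum_const, ← Set.ncard_eq_toFinset_card _ hg, nsmul_eq_mul]
    refine mul_div_cancel_left₀ _ ?_
    have : (conjugatesOf g).ncard ≠ 0 := by
      exact Set.ncard_ne_zero_of_mem (mem_conjugatesOf_self (a := g)) hg
    exact_mod_cast this
  · rw [classAverage_of_infinite hg]
    by_contra hne
    apply hg
    have h := lp.memℓp f
    rw [memℓp_gen_iff (by norm_num)] at h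
    have h0 : 0 < ‖f g‖ ^ (2 : ENNReal).toReal := by
      have : 0 < ‖f g‖ := norm_pos_iff.2 (Ne.symm hne)
      positivity
    have h1 := h.tendsto_cofinite_zero.eventually (gt_mem_nhds h0)
    rw [Filter.eventually_cofinite] at h1
    refine h1.subset fun x hx => ?_
    rw [Set.mem_ofPred_eq, hc x hx]
    exact lt_irrefl _

/-- Conjugation of `a ∈ 𝓝(G)` by `g ∈ G`. -/
def conjNG (g : G) (a : NG G) : NG G := leftRegularNG G g * a * leftRegularNG G g⁻¹

theorem conjNG_apply (g : G) (a : NG G) (f : L2 G) :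
    (conjNG g a : L2 G →L[ℂ] L2 G) f =
      leftRegular G g ((a : L2 G →L[ℂ] L2 G) (leftRegular G g⁻¹ f)) := rfl

theorem conjNG_delta (g : G) (a : NG G) :
    (conjNG g a : L2 G →L[ℂ] L2 G) (delta 1) =
      permute (MulAut.conj g).toEquiv ((a : L2 G →L[ℂ] L2 G) (delta 1)) := by
  ext x
  rw [conjNG_apply, leftRegular_apply, leftRegular_delta, NG_delta, permute_apply]
  simp [fourier]

theorem fourier_conjNG (g : G) (a : NG G) (x : G) :
    fourier (conjNG g a : L2 G →L[ℂ] L2 G) x = fourier (a : L2 G →L[ℂ] L2 G) (g⁻¹ * x * g) := by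
  rw [fourier, conjNG_apply, leftRegular_apply, leftRegular_delta, NG_delta]
  simp

theorem norm_leftRegular_apply (g : G) (f : L2 G) : ‖leftRegular G g f‖ = ‖f‖ :=
  (permute (Equiv.mulLeft g)).norm_map f

theorem norm_conjNG_le (g : G) (a : NG G) :
    ‖(conjNG g a : L2 G →L[ℂ] L2 G)‖ ≤ ‖(a : L2 G →L[ℂ] L2 G)‖ := by
  refine ContinuousLinearMap.opNorm_le_bound _ (norm_nonneg _) fun f => ?_
  rw [conjNG_apply, norm_leftRegular_apply, ← norm_leftRegular_apply g⁻¹ f]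
  exact ContinuousLinearMap.le_opNorm _ _

theorem isPositive_conjNG (g : G) {a : NG G} (ha : (a : L2 G →L[ℂ] L2 G).IsPositive) :
    (conjNG g a : L2 G →L[ℂ] L2 G).IsPositive := by
  have h := ha.conj_adjoint (leftRegular G g)
  rw [← ContinuousLinearMap.star_eq_adjoint, star_leftRegular] at h
  exact h

theorem isPositive_of_tendsto {G : Type*} {u : ℕ → L2 G →L[ℂ] L2 G} {T : L2 G →L[ℂ] L2 G}
    (hu : ∀ n, (u n).IsPositive)
    (h : ∀ f, Filter.Tendsto (fun n => u n f) Filter.atTop (nhds (T f))) : T.IsPositive := by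
  rw [ContinuousLinearMap.isPositive_iff_complex]
  intro f
  have h1 : Filter.Tendsto (fun n => inner ℂ (u n f) f) Filter.atTop (nhds (inner ℂ (T f) f)) :=
    (h f).inner tendsto_const_nhds
  have h2 := (Complex.continuous_re.tendsto _).comp h1
  have h3 := fun n => (ContinuousLinearMap.isPositive_iff_complex _).1 (hu n) f
  refine ⟨?_, ge_of_tendsto h2 (Filter.Eventually.of_forall fun n => (h3 n).2)⟩
  refine tendsto_nhds_unique ?_ h1
  refine ((Complex.continuous_ofReal.tendsto _).comp h2).congr fun n => (h3 n).1

theorem mem_center_of_fourier {T : NG G}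
    (hT : ∀ h x, fourier (T : L2 G →L[ℂ] L2 G) (h⁻¹ * x * h) = fourier (T : L2 G →L[ℂ] L2 G) x) :
    T ∈ Subalgebra.center ℂ (NG G) := by
  rw [Subalgebra.mem_center_iff]
  intro b
  have hc : ∀ g, leftRegular G g * (T : L2 G →L[ℂ] L2 G) = (T : L2 G →L[ℂ] L2 G) * leftRegular G g := by
    intro g
    have h1 : conjNG g T = T := fourier_injective fun x => by rw [fourier_conjNG, hT]
    have h2 : leftRegularNG G g * T = T * leftRegularNG G g := by
      conv_rhs => rw [← h1]
      rw [conjNG, mul_assoc, ← map_mul]; simp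
    exact congrArg Subtype.val h2
  exact Subtype.ext (mem_NG_iff.1 b.2 _ hc).symm

theorem fourier_of_mem_center {T : NG G} (hT : T ∈ Subalgebra.center ℂ (NG G)) (h x : G) :
    fourier (T : L2 G →L[ℂ] L2 G) (h⁻¹ * x * h) = fourier (T : L2 G →L[ℂ] L2 G) x := by
  rw [← fourier_conjNG]
  congr 2
  rw [conjNG, Subalgebra.mem_center_iff.1 hT, mul_assoc, ← map_mul]; simp

/-- For `a ∈ 𝓝(G)` the class-averaged Fourier coefficients of `a` are the Fourier coefficients of an
element of the centre of `𝓝(G)`, which is positive if `a` is. -/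
theorem exists_centerTrace (a : NG G) : ∃ T : Subalgebra.center ℂ (NG G),
    (∀ g, fourier ((T : NG G) : L2 G →L[ℂ] L2 G) g =
      classAverage (fourier (a : L2 G →L[ℂ] L2 G)) g) ∧
    ((a : L2 G →L[ℂ] L2 G).IsPositive → ((T : NG G) : L2 G →L[ℂ] L2 G).IsPositive) := by
  let W : Set (NG G) := {b | ‖(b : L2 G →L[ℂ] L2 G)‖ ≤ ‖(a : L2 G →L[ℂ] L2 G)‖ ∧
    ((a : L2 G →L[ℂ] L2 G).IsPositive → (b : L2 G →L[ℂ] L2 G).IsPositive) ∧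
    ∀ g, classAverage (fourier (b : L2 G →L[ℂ] L2 G)) g =
      classAverage (fourier (a : L2 G →L[ℂ] L2 G)) g}
  let K : Set (L2 G) := (fun b : NG G => (b : L2 G →L[ℂ] L2 G) (delta 1)) '' W
  have hcl : IsClosed K := by
    refine IsSeqClosed.isClosed fun v η hv hη => ?_
    choose u huW hu using hv
    obtain ⟨T, hT⟩ := exists_limit (u := u) (fun n => (huW n).1) (η := η)
      (by simpa only [hu] using hη)
    refine ⟨T, ⟨?_, ?_, ?_⟩, ?_⟩
    · refine ContinuousLinearMap.opNorm_le_bound _ (norm_nonneg _) fun f => ?_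
      refine le_of_tendsto (hT f).norm (Filter.Eventually.of_forall fun n => ?_)
      exact (ContinuousLinearMap.le_opNorm _ _).trans
        (mul_le_mul_of_nonneg_right (huW n).1 (norm_nonneg _))
    · exact fun ha => isPositive_of_tendsto (fun n => (huW n).2.1 ha) hT
    · intro g
      by_cases hg : (conjugatesOf g).Finite
      · have hx : ∀ x, Filter.Tendsto (fun n => fourier (u n : L2 G →L[ℂ] L2 G) x) Filter.atTop
            (nhds (fourier (T : L2 G →L[ℂ] L2 G) x)) := by
          intro x
          have := (hT (delta 1)).inner (𝕜 := ℂ) (tendsto_const_nhds (x := (delta x : L2 G)))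
          have h2 := (continuous_star.tendsto _).comp this
          simp only [Function.comp_def] at h2
          have e : ∀ f : L2 G, star (inner ℂ f (delta x)) = f x := fun f => by
            rw [← inner_delta]; exact inner_conj_symm _ _
          simp only [e] at h2
          exact h2
        have h1 : Filter.Tendsto (fun n => classAverage (fourier (u n : L2 G →L[ℂ] L2 G)) g)
            Filter.atTop (nhds (classAverage (fourier (T : L2 G →L[ℂ] L2 G)) g)) := by
          simp only [classAverage_of_finite hg]
          exact (tendsto_finsetSum _ fun x _ => hx x).div_const _
        have h2 : (fun n => classAverage (fourier (u n : L2 G →L[ℂ] L2 G)) g) =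
            fun _ => classAverage (fourier (a : L2 G →L[ℂ] L2 G)) g :=
          funext fun n => (huW n).2.2 g
        rw [h2] at h1
        exact tendsto_nhds_unique h1 tendsto_const_nhds
      · simp [classAverage_of_infinite hg]
    · refine tendsto_nhds_unique (hT (delta 1)) ?_
      simpa only [hu] using hη
  have hconv : ∀ x ∈ K, ∀ y ∈ K, ∀ s t : ℝ, 0 ≤ s → 0 ≤ t → s + t = 1 →
      (s : ℂ) • x + (t : ℂ) • y ∈ K := by
    rintro _ ⟨b, hb, rfl⟩ _ ⟨c, hc, rfl⟩ s t hs ht hst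
    refine ⟨(s : ℂ) • b + (t : ℂ) • c, ⟨?_, ?_, ?_⟩, rfl⟩
    · change ‖(s : ℂ) • (b : L2 G →L[ℂ] L2 G) + (t : ℂ) • (c : L2 G →L[ℂ] L2 G)‖ ≤ _
      refine (norm_add_le _ _).trans ?_
      rw [norm_smul, norm_smul, Complex.norm_of_nonneg hs, Complex.norm_of_nonneg ht]
      have h1 := mul_le_mul_of_nonneg_left hb.1 hs
      have h2 := mul_le_mul_of_nonneg_left hc.1 ht
      calc _ ≤ (s + t) * ‖(a : L2 G →L[ℂ] L2 G)‖ := by rw [add_mul]; exact add_le_add h1 h2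
        _ = _ := by rw [hst, one_mul]
    · intro ha
      change ((s : ℂ) • (b : L2 G →L[ℂ] L2 G) + (t : ℂ) • (c : L2 G →L[ℂ] L2 G)).IsPositive
      exact ((hb.2.1 ha).smul_of_nonneg (by exact_mod_cast hs)).add
        ((hc.2.1 ha).smul_of_nonneg (by exact_mod_cast ht))
    · intro g
      have : fourier (((s : ℂ) • b + (t : ℂ) • c : NG G) : L2 G →L[ℂ] L2 G) =
          fun x => (s : ℂ) * fourier (b : L2 G →L[ℂ] L2 G) x +
            (t : ℂ) * fourier (c : L2 G →L[ℂ] L2 G) x := rfl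
      rw [this, classAverage_linear, hb.2.2, hc.2.2, ← add_mul]
      have : (s : ℂ) + t = 1 := by exact_mod_cast hst
      rw [this, one_mul]
  obtain ⟨η, ⟨T, hTW, rfl⟩, hmin⟩ := exists_min_norm (K := K)
    ⟨_, a, ⟨le_rfl, id, fun _ => rfl⟩, rfl⟩ hcl hconv
  have hinv : ∀ h x, fourier (T : L2 G →L[ℂ] L2 G) (h⁻¹ * x * h) =
      fourier (T : L2 G →L[ℂ] L2 G) x := by
    intro h x
    have hW : conjNG h T ∈ W := by
      refine ⟨(norm_conjNG_le h T).trans hTW.1, fun ha => isPositive_conjNG h (hTW.2.1 ha),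
        fun g => ?_⟩
      rw [← hTW.2.2 g, ← classAverage_conj h (fourier (T : L2 G →L[ℂ] L2 G)) g]
      congr 1
      ext x
      rw [fourier_conjNG]
    have h1 := hmin _ ⟨_, hW, rfl⟩ (by
      simp only [conjNG_delta]
      rw [LinearIsometry.norm_map])
    rw [← fourier_conjNG]
    exact congrArg (fun f : L2 G => f x) h1
  refine ⟨⟨T, mem_center_of_fourier hinv⟩, fun g => ?_, hTW.2.1⟩
  rw [← hTW.2.2 g]
  exact (classAverage_eq_self (f := (T : L2 G →L[ℂ] L2 G) (delta 1)) hinv g).symm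

/-- The central element whose Fourier coefficients are the class averages of those of `a`. -/
def centerTraceFun (a : NG G) : Subalgebra.center ℂ (NG G) := (exists_centerTrace a).choose

theorem fourier_centerTraceFun (a : NG G) (g : G) :
    fourier ((centerTraceFun a : NG G) : L2 G →L[ℂ] L2 G) g =
      classAverage (fourier (a : L2 G →L[ℂ] L2 G)) g :=
  (exists_centerTrace a).choose_spec.1 g

theorem center_ext {S T : Subalgebra.center ℂ (NG G)}
    (h : ∀ g, fourier ((S : NG G) : L2 G →L[ℂ] L2 G) g =
      fourier ((T : NG G) : L2 G →L[ℂ] L2 G) g) : S = T :=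
  Subtype.ext (fourier_injective h)

variable (G) in
/-- The centre-valued trace `tr^u : 𝓝(G) → Z(𝓝(G))`, obtained by averaging Fourier coefficients over
conjugacy classes. That it has the defining properties of the centre-valued trace is
`centerTrace_isCenterValuedTrace`. -/
def centerTrace : NG G →ₗ[ℂ] Subalgebra.center ℂ (NG G) where
  toFun := centerTraceFun
  map_add' a b := by
    refine center_ext fun g => ?_
    have e : fourier ((a + b : NG G) : L2 G →L[ℂ] L2 G) = fun x =>
        1 * fourier (a : L2 G →L[ℂ] L2 G) x + 1 * fourier (b : L2 G →L[ℂ] L2 G) x := by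
      ext x; rw [one_mul, one_mul]; rfl
    have e' : fourier (((centerTraceFun a + centerTraceFun b : Subalgebra.center ℂ (NG G)) :
        NG G) : L2 G →L[ℂ] L2 G) g = fourier ((centerTraceFun a : NG G) : L2 G →L[ℂ] L2 G) g +
        fourier ((centerTraceFun b : NG G) : L2 G →L[ℂ] L2 G) g := rfl
    rw [e', fourier_centerTraceFun, e, classAverage_linear, one_mul, one_mul,
      fourier_centerTraceFun, fourier_centerTraceFun]
  map_smul' c a := by
    refine center_ext fun g => ?_
    have e : fourier ((c • a : NG G) : L2 G →L[ℂ] L2 G) = fun x =>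
        c * fourier (a : L2 G →L[ℂ] L2 G) x + 0 * fourier (a : L2 G →L[ℂ] L2 G) x := by
      ext x; rw [zero_mul, add_zero]; rfl
    have e' : fourier (((c • centerTraceFun a : Subalgebra.center ℂ (NG G)) :
        NG G) : L2 G →L[ℂ] L2 G) g =
        c * fourier ((centerTraceFun a : NG G) : L2 G →L[ℂ] L2 G) g := rfl
    rw [RingHom.id_apply, e', fourier_centerTraceFun, e, classAverage_linear, zero_mul, add_zero,
      fourier_centerTraceFun]

theorem fourier_centerTrace (a : NG G) (g : G) :
    fourier ((centerTrace G a : NG G) : L2 G →L[ℂ] L2 G) g =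
      classAverage (fourier (a : L2 G →L[ℂ] L2 G)) g := fourier_centerTraceFun a g

variable (G) in
/-- The defining properties of the centre-valued trace of `𝓝(G)`: a `ℂ`-linear map to the centre
that is tracial, is the identity on the centre, and preserves positivity. -/
structure IsCenterValuedTrace (τ : NG G →ₗ[ℂ] Subalgebra.center ℂ (NG G)) : Prop where
  mul_comm : ∀ a b : NG G, τ (a * b) = τ (b * a)
  center : ∀ c : Subalgebra.center ℂ (NG G), τ (c : NG G) = c
  positive : ∀ a : NG G, (a : L2 G →L[ℂ] L2 G).IsPositive →
    ((τ a : NG G) : L2 G →L[ℂ] L2 G).IsPositive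

theorem hasSum_fourier_mul (a b : NG G) (x : G) :
    HasSum (fun y => fourier (a : L2 G →L[ℂ] L2 G) (x * y⁻¹) * fourier (b : L2 G →L[ℂ] L2 G) y)
      (fourier ((a * b : NG G) : L2 G →L[ℂ] L2 G) x) := by
  have h := lp.hasSum_inner (𝕜 := ℂ) (G := fun _ : G => ℂ)
    (ContinuousLinearMap.adjoint (a : L2 G →L[ℂ] L2 G) (delta x))
    ((b : L2 G →L[ℂ] L2 G) (delta 1))
  rw [ContinuousLinearMap.adjoint_inner_left, inner_delta] at h
  refine h.congr_fun fun y => ?_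
  rw [← NG_delta, ← inner_delta x, ← ContinuousLinearMap.adjoint_inner_left,
    ← inner_conj_symm, inner_delta]
  simp [fourier, mul_comm]

theorem centerTrace_isCenterValuedTrace : IsCenterValuedTrace G (centerTrace G) where
  mul_comm a b := by
    refine center_ext fun g => ?_
    rw [fourier_centerTrace, fourier_centerTrace]
    by_cases hg : (conjugatesOf g).Finite
    · rw [classAverage_of_finite hg, classAverage_of_finite hg]
      congr 1
      have h1 := hasSum_sum (s := hg.toFinset) fun x _ => hasSum_fourier_mul a b x
      have h2 := hasSum_sum (s := hg.toFinset) fun x _ =>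
        ((Equiv.inv G).trans (Equiv.mulRight x)).hasSum_iff.2 (hasSum_fourier_mul b a x)
      refine h1.unique (h2.congr_fun fun y => ?_)
      refine Finset.sum_bij' (fun x _ => y * x * y⁻¹) (fun x _ => y⁻¹ * x * y) ?_ ?_ ?_ ?_ ?_
      · intro x hx
        rw [Set.Finite.mem_toFinset] at hx ⊢
        exact IsConj.trans (b := x) hx (isConj_iff.2 ⟨y, by group⟩)
      · intro x hx
        rw [Set.Finite.mem_toFinset] at hx ⊢
        exact IsConj.trans (b := x) hx (isConj_iff.2 ⟨y⁻¹, by group⟩)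
      · intro x _; group
      · intro x _; group
      · intro x _
        simp [mul_assoc, _root_.mul_comm]
    · simp [classAverage_of_infinite hg]
  center c := by
    refine center_ext fun g => ?_
    rw [fourier_centerTrace]
    exact classAverage_eq_self (f := ((c : NG G) : L2 G →L[ℂ] L2 G) (delta 1))
      (fourier_of_mem_center c.2) g
  positive a ha := (exists_centerTrace a).choose_spec.2 ha

/-! ### Canonical trace and von Neumann dimension -/

/-- The canonical trace `tr_G(a) = ⟨a δ_e, δ_e⟩`. -/
def canonicalTrace (a : L2 G →L[ℂ] L2 G) : ℂ := inner ℂ (delta 1) (a (delta 1))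

/-- The von Neumann dimension of a (closed, right `G`-invariant) subspace `V ⊆ ℓ²(G)`: the canonical
trace of the orthogonal projection onto `V` (its closure, if `V` is not closed). -/
def vnDim (V : Submodule ℂ (L2 G)) : ℝ :=
  (canonicalTrace V.topologicalClosure.starProjection).re

/-- The subspace `x · ℓ²(G)`. -/
def leftImage (x : MonoidAlgebra ℂ G) : Submodule ℂ (L2 G) :=
  LinearMap.range ((groupRingToNG G x : L2 G →L[ℂ] L2 G) : L2 G →ₗ[ℂ] L2 G)

/-! ### Group rings of subgroups over subfields, and their central idempotents -/

variable (G) in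
/-- `Δ⁺(G)`, the largest finite normal subgroup of `G`, as the subgroup generated by all finite normal
subgroups. It is itself finite and normal when the orders of the finite subgroups of `G` are
bounded. -/
def deltaPlus : Subgroup G := sSup {N : Subgroup G | N.Normal ∧ Finite N}

/-- `K[H]` as a subring of `ℂ[G]`: the elements supported on `H` with coefficients in `K`. -/
def subgroupRing (K : Subfield ℂ) (H : Subgroup G) : Subring (MonoidAlgebra ℂ G) where
  carrier := {x | (∀ g, x.coeff g ∈ K) ∧ ∀ g, x.coeff g ≠ 0 → g ∈ H}
  zero_mem' := ⟨fun g => K.zero_mem, fun g h => absurd rfl h⟩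
  one_mem' := by
    classical
    refine ⟨fun g => ?_, fun g => ?_⟩
    · rw [MonoidAlgebra.one_def, MonoidAlgebra.coeff_single, Finsupp.single_apply]
      split_ifs
      exacts [K.one_mem, K.zero_mem]
    · rw [MonoidAlgebra.one_def, MonoidAlgebra.coeff_single, Finsupp.single_apply]
      split_ifs with h
      · exact fun _ => h ▸ H.one_mem
      · exact fun h => absurd rfl h
  add_mem' := by
    rintro x y ⟨hx, hx'⟩ ⟨hy, hy'⟩
    refine ⟨fun g => K.add_mem (hx g) (hy g), fun g hg => ?_⟩
    by_contra hgH
    have h1 : x.coeff g = 0 := by_contra fun h => hgH (hx' g h)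
    have h2 : y.coeff g = 0 := by_contra fun h => hgH (hy' g h)
    exact hg (by rw [MonoidAlgebra.coeff_add, Finsupp.add_apply, h1, h2, add_zero])
  neg_mem' := by
    rintro x ⟨hx, hx'⟩
    exact ⟨fun g => K.neg_mem (hx g), fun g hg => hx' g (neg_ne_zero.1 hg)⟩
  mul_mem' := by
    classical
    rintro x y ⟨hx, hx'⟩ ⟨hy, hy'⟩
    refine ⟨fun g => ?_, fun g hg => ?_⟩
    · rw [MonoidAlgebra.coeff_mul]
      refine K.sum_mem fun a _ => K.sum_mem fun b _ => ?_
      beta_reduce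
      split_ifs
      exacts [K.mul_mem (hx a) (hy b), K.zero_mem]
    · rw [MonoidAlgebra.coeff_mul] at hg
      obtain ⟨a, ha, hg⟩ := Finset.exists_ne_zero_of_sum_ne_zero hg
      obtain ⟨b, hb, hg⟩ := Finset.exists_ne_zero_of_sum_ne_zero hg
      have hab : a * b = g := by
        by_contra h
        exact hg (if_neg h)
      rw [← hab]
      exact H.mul_mem (hx' a (Finsupp.mem_support_iff.1 ha)) (hy' b (Finsupp.mem_support_iff.1 hb))

/-- The complex dimension of the right ideal `x · ℂ[H]`. -/
def idealDim (x : MonoidAlgebra ℂ G) (H : Subgroup G) : ℕ :=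
  Module.finrank ℂ (Submodule.span ℂ ((fun y => x * y) '' (subgroupRing ⊤ H : Set (MonoidAlgebra ℂ G))))

/-- A projection of `K[H]`: an element of `K[H]` that is a self-adjoint idempotent of `𝓝(G)`. -/
def IsProjectionIn (K : Subfield ℂ) (H : Subgroup G) (x : MonoidAlgebra ℂ G) : Prop :=
  x ∈ subgroupRing K H ∧ IsStarProjection (groupRingToNG G x)

/-- A nonzero projection of `K[H]` that is not the sum of two nonzero projections of `K[H]` with
product zero. -/
structure IsIrreducibleProjection (K : Subfield ℂ) (H : Subgroup G) (Q : MonoidAlgebra ℂ G) :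
    Prop where
  isProjectionIn : IsProjectionIn K H Q
  ne_zero : Q ≠ 0
  irreducible : ∀ Q₁ Q₂, IsProjectionIn K H Q₁ → IsProjectionIn K H Q₂ → Q = Q₁ + Q₂ →
    Q₁ * Q₂ = 0 → Q₁ = 0 ∨ Q₂ = 0

/-- The centre `Z(K[Δ⁺])`. -/
def deltaCenter (G : Type*) [Group G] (K : Subfield ℂ) : Subring (MonoidAlgebra ℂ G) :=
  subgroupRing K (deltaPlus G) ⊓
    Subring.centralizer (subgroupRing K (deltaPlus G) : Set (MonoidAlgebra ℂ G))

/-- `Z(𝓝(G)) ∩ Z(K[Δ⁺])`. -/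
def invariantCenter (G : Type*) [Group G] (K : Subfield ℂ) : Subring (MonoidAlgebra ℂ G) :=
  deltaCenter G K ⊓ (Subalgebra.center ℂ (NG G)).toSubring.comap (groupRingToNG G).toRingHom

/-- A primitive idempotent of a commutative ring `R` (given as a subring of `A`): a nonzero idempotent
of `R` that is not the sum of two nonzero orthogonal idempotents of `R`. -/
structure IsPrimitiveIdempotent {A : Type*} [Ring A] (R : Subring A) (e : A) : Prop where
  mem : e ∈ R
  idem : IsIdempotentElem e
  ne_zero : e ≠ 0
  primitive : ∀ e₁ ∈ R, ∀ e₂ ∈ R, IsIdempotentElem e₁ → IsIdempotentElem e₂ → e₁ * e₂ = 0 →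
    e = e₁ + e₂ → e₁ = 0 ∨ e₂ = 0

/-- The set of conjugates `g p g⁻¹`, `g ∈ G`, of `p ∈ ℂ[G]`. -/
def conjugates (p : MonoidAlgebra ℂ G) : Set (MonoidAlgebra ℂ G) :=
  {q | ∃ g : G, q = MonoidAlgebra.single g 1 * p * MonoidAlgebra.single g⁻¹ 1}

/-- The set of the central projections `P^i`: sums of the distinct `G`-conjugates of a primitive central
idempotent of `K[Δ⁺]`. -/
def centralProjections (G : Type*) [Group G] (K : Subfield ℂ) : Set (MonoidAlgebra ℂ G) :=
  {P | ∃ p, IsPrimitiveIdempotent (deltaCenter G K) p ∧ P = ∑ᶠ q ∈ conjugates p, q}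

end GroupVN
end

noncomputable section

namespace GroupVN

/-! ### Traces of modules over semisimple algebras -/

/-! The Fourier coefficients of `tr^u(Q)` are class averages of those of `Q`. They vanish on
infinite classes, and `Q` lives on a finite group, so only elements of finite order with finitely
many conjugates matter. By Dietzmann's lemma (`mem_deltaPlus`) these lie in `Δ⁺`. Hence on elements
supported in a fixed finite subgroup `tr^u` sees only the coefficients on `Δ⁺`
(`ringTrace_eq_of_coeff_eq`).

Replacing `Q` by `∑ h Q h⁻¹` over `h ∈ H` multiplies the trace by `|H|`. The coefficient of this sum
at `d ∈ Δ⁺` is the value at `d⁻¹` of the character of the `K[Δ⁺]`-module `K[H] Q`. Maschke's theorem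
makes `K[Δ⁺]` semisimple, and all simple modules in the block of a primitive central idempotent `q`
are isomorphic. The character of any module, cut down to that block, is therefore a multiple of the
regular one, whose coefficients are those of `q` (`exists_trace_eq_mul_trace`,
`exists_character_eq`). When `QP = Q`, cutting `P` into the conjugates `q` of `p` shows that the
average of `Q` agrees on `Δ⁺` with some `∑ c_q q`. Conjugate idempotents have equal trace, so each
`q` has trace `P / #orbit`, and `tr^u(Q)` is a scalar multiple of `P` (`exists_ringTrace_eq_smul`).

The scalar is read off at the identity, whose class is a singleton: it is `Q(1) / P(1)`. For a
projection the coefficient at `1` is the von Neumann dimension of its image (`vnDim_leftImage`). In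
a finite group ring it is the dimension of the ideal divided by the group order (`idealDim_eq`).
This gives both formulas.

Existence of `P`: `1` is a sum of primitive central idempotents of `K[Δ⁺]`, each `P` is a central
projection of `K[H]`, and irreducibility leaves only `QP = 0` or `QP = Q`, where `QP = 0` for every
`P` would force `Q = 0`. Uniqueness: distinct orbit sums are orthogonal. -/

theorem trace_lsmul_congr {R : Type*} [Ring R] {F : Type*} [Field F] [Algebra F R]
    {M N : Type*} [AddCommGroup M] [Module F M] [Module R M]
    [IsScalarTower F R M] [AddCommGroup N] [Module F N] [Module R N] [IsScalarTower F R N]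
    (φ : M ≃ₗ[R] N) (x : R) :
    LinearMap.trace F M (Algebra.lsmul F F M x) = LinearMap.trace F N (Algebra.lsmul F F N x) := by
  rw [← LinearMap.trace_conj' _ (φ.restrictScalars F)]
  congr 1
  ext n
  simp [LinearEquiv.conj_apply]

section Semisimple

variable {R : Type*} [Ring R] [IsSemisimpleRing R]

/-- In a semisimple ring a two-sided ideal is generated by a central idempotent. -/
theorem exists_central_idempotent (I : Ideal R) [I.IsTwoSided] :
    ∃ f : R, IsIdempotentElem f ∧ f ∈ Subring.center R ∧ I = Ideal.span {f} := by
  obtain ⟨f, hf, rfl⟩ := IsSemisimpleRing.ideal_eq_span_idempotent I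
  set I : Ideal R := Ideal.span {f} with hI
  have hfI : f ∈ I := Ideal.subset_span rfl
  have hr : ∀ x ∈ I, x * f = x := by
    intro x hx
    obtain ⟨a, rfl⟩ := Ideal.mem_span_singleton'.1 hx
    rw [mul_assoc, hf.eq]
  -- The part of `I` killed by `f` on the left. Its idempotent generator `j` satisfies `j = j f j =
  -- 0`, so `f` is a left as well as a right unit of `I`; then `r f = f r f = f r` for all `r`.
  let J : Ideal R :=
    { carrier := {x | x ∈ I ∧ f * x = 0}
      zero_mem' := ⟨I.zero_mem, mul_zero f⟩
      add_mem' := fun {x y} hx hy => ⟨I.add_mem hx.1 hy.1, by rw [mul_add, hx.2, hy.2, add_zero]⟩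
      smul_mem' := fun r x hx => ⟨I.mul_mem_left r hx.1, by
        rw [smul_eq_mul, ← mul_assoc, ← hr (f * r) (I.mul_mem_right r hfI), mul_assoc, hx.2,
          mul_zero]⟩ }
  have hJ : ∀ x ∈ J, x = 0 := by
    obtain ⟨j, hj, hjJ⟩ := IsSemisimpleRing.ideal_eq_span_idempotent J
    have hj' : j ∈ J := hjJ ▸ Ideal.subset_span rfl
    have hj0 : j = 0 := by
      calc j = j * f * j := by rw [hr j hj'.1, hj.eq]
        _ = 0 := by rw [mul_assoc, hj'.2, mul_zero]
    intro x hx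
    rw [hjJ, hj0] at hx
    simpa using hx
  have hl : ∀ x ∈ I, f * x = x := by
    intro x hx
    have := hJ (x - f * x) ⟨I.sub_mem hx (I.mul_mem_left f hx), by
      rw [mul_sub, ← mul_assoc, hf.eq, sub_self]⟩
    exact (sub_eq_zero.1 this).symm
  refine ⟨f, hf, Subring.mem_center_iff.2 fun r => ?_, rfl⟩
  rw [← hl (r * f) (I.mul_mem_left r hfI), ← hr (f * r) (I.mul_mem_right r hfI), mul_assoc]

/-- Two simple modules on which the same primitive central idempotent acts as the identity are
isomorphic. -/
theorem nonempty_linearEquiv_of_primitive {e : R}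
    (he : IsPrimitiveIdempotent (Subring.center R) e)
    {S T : Type*} [AddCommGroup S] [Module R S] [IsSimpleModule R S]
    [AddCommGroup T] [Module R T] [IsSimpleModule R T]
    (hS : ∀ s : S, e • s = s) (hT : ∀ t : T, e • t = t) : Nonempty (T ≃ₗ[R] S) := by
  obtain ⟨f, hf, hfc, hfI⟩ := exists_central_idempotent (Module.annihilator R S)
  have hec := Subring.mem_center_iff.1 he.mem
  have hfS : ∀ s : S, f • s = 0 :=
    Module.mem_annihilator.1 (hfI ▸ Ideal.subset_span rfl : f ∈ Module.annihilator R S)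
  -- Primitivity is applied to `e = e f + (e - e f)`. The case `e = e f` is excluded because `f`
  -- kills `S` while `e` is the identity there.
  have hfe : f * e = 0 := by
    have h1 : IsIdempotentElem (e * f) := by
      rw [IsIdempotentElem, mul_assoc, ← mul_assoc f, hec f, mul_assoc e f, hf.eq, ← mul_assoc,
        he.idem.eq]
    have h2 : e * f * (e - e * f) = 0 := by
      rw [mul_sub, h1.eq, mul_assoc, hec f, ← mul_assoc, he.idem.eq, sub_self]
    have h3 : (e - e * f) * (e * f) = 0 := by
      rw [sub_mul, h1.eq, ← mul_assoc, he.idem.eq, sub_self]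
    have h4 : IsIdempotentElem (e - e * f) := by
      rw [IsIdempotentElem, mul_sub, h3, sub_zero, sub_mul, he.idem.eq, mul_assoc, hec f, ← mul_assoc,
        he.idem.eq]
    have hefc := (Subring.center R).mul_mem he.mem hfc
    rcases he.primitive _ hefc _ ((Subring.center R).sub_mem he.mem hefc) h1 h4 h2 (by abel) with h | h
    · rw [hec f, h]
    · exfalso
      have := IsSimpleModule.nontrivial R S
      obtain ⟨s, hs⟩ := exists_ne (0 : S)
      apply hs
      rw [← hS s, sub_eq_zero.1 h, mul_smul, hfS, smul_zero]
  have hfT : ∀ t : T, f • t = 0 := fun t => by rw [← hT t, ← mul_smul, hfe, zero_smul]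
  obtain ⟨J, ⟨φ⟩⟩ := IsSemisimpleRing.exists_linearEquiv_ideal_of_isSimpleModule R T
  have : IsSimpleModule R J := IsSimpleModule.congr φ.symm
  obtain ⟨j, hj, hjJ⟩ := IsSemisimpleRing.ideal_eq_span_idempotent J
  have hjm : j ∈ J := hjJ ▸ Ideal.subset_span rfl
  -- If `j` annihilated `S` then `j = a f`; since `f` kills `J ≅ T`, this gives `j = j j = a f j =
  -- 0`. A vector `s` with `j s ≠ 0` then yields the nonzero map `x ↦ x s` from `J` to `S`, an
  -- isomorphism by Schur.
  have hjS : j ∉ Module.annihilator R S := by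
    intro hmem
    rw [hfI] at hmem
    obtain ⟨a, ha⟩ := Ideal.mem_span_singleton'.1 hmem
    have h1 : f • φ.symm ⟨j, hjm⟩ = 0 := hfT _
    rw [← map_smul, LinearEquiv.map_eq_zero_iff] at h1
    have h2 : f * j = 0 := congrArg Subtype.val h1
    have h3 : j = 0 := by
      rw [← hj.eq]
      nth_rw 1 [← ha]
      rw [mul_assoc, h2, mul_zero]
    have := IsSimpleModule.nontrivial R J
    obtain ⟨x, hx⟩ := exists_ne (0 : J)
    apply hx
    have hxJ : (x : R) ∈ Ideal.span {j} := hjJ.le x.2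
    rw [h3] at hxJ
    exact Subtype.ext (by simpa using hxJ)
  rw [Module.mem_annihilator] at hjS
  push Not at hjS
  obtain ⟨s, hs⟩ := hjS
  let ψ : J →ₗ[R] S := (LinearMap.toSpanSingleton R S s).comp J.subtype
  have hψ : ψ ≠ 0 := fun h => hs (by simpa [ψ] using LinearMap.congr_fun h ⟨j, hjm⟩)
  exact ⟨φ.trans (LinearEquiv.ofBijective ψ (LinearMap.bijective_of_ne_zero hψ))⟩

variable {F : Type*} [Field F] [Algebra F R]

/-- The number `m` is the multiplicity of `S` in `M`. By induction on dimension a simple summand is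
split off. The central idempotent `e` acts on it as the identity or as zero by Schur; in the first
case the summand is isomorphic to `S`, in the second it contributes nothing. -/
theorem exists_nat_trace_eq {e : R} (he : IsPrimitiveIdempotent (Subring.center R) e)
    (S : Type*) [AddCommGroup S] [Module F S] [Module R S] [IsScalarTower F R S]
    [IsSimpleModule R S] (hS : ∀ s : S, e • s = s)
    {M : Type*} [AddCommGroup M] [Module F M] [Module R M] [IsScalarTower F R M]
    [FiniteDimensional F M] :
    ∃ m : ℕ, ∀ x : R, LinearMap.trace F M (Algebra.lsmul F F M (x * e)) =
      m * LinearMap.trace F S (Algebra.lsmul F F S (x * e)) := by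
  have hec := Subring.mem_center_iff.1 he.mem
  induction hn : Module.finrank F M using Nat.strong_induction_on generalizing M with
  | _ n ih =>
    rcases subsingleton_or_nontrivial M with hM | hM
    · refine ⟨0, fun x => ?_⟩
      rw [Subsingleton.elim (Algebra.lsmul F F M (x * e)) 0]; simp
    obtain ⟨p, hp⟩ := IsSemisimpleModule.exists_simple_submodule R M
    obtain ⟨q, hpq⟩ := exists_isCompl p
    have hfp : FiniteDimensional F p := inferInstanceAs (FiniteDimensional F (p.restrictScalars F))
    have hfq : FiniteDimensional F q := inferInstanceAs (FiniteDimensional F (q.restrictScalars F))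
    have hsum : ∀ x : R, LinearMap.trace F M (Algebra.lsmul F F M x) =
        LinearMap.trace F p (Algebra.lsmul F F p x) +
        LinearMap.trace F q (Algebra.lsmul F F q x) := by
      intro x
      rw [← trace_lsmul_congr (Submodule.prodEquivOfIsCompl p q hpq), ← LinearMap.trace_prodMap']
      rfl
    obtain ⟨m, hm⟩ := ih (Module.finrank F q) (by
      have h1 := ((Submodule.prodEquivOfIsCompl p q hpq).restrictScalars F).finrank_eq
      have := IsSimpleModule.nontrivial R p
      have h2 : 0 < Module.finrank F p := Module.finrank_pos
      rw [Module.finrank_prod] at h1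
      omega) (M := q) rfl
    by_cases hep : ∀ s : p, e • s = s
    · obtain ⟨φ⟩ := nonempty_linearEquiv_of_primitive he hS hep
      refine ⟨m + 1, fun x => ?_⟩
      rw [hsum, hm, trace_lsmul_congr φ]
      push_cast; ring
    · refine ⟨m, fun x => ?_⟩
      have h0 : ∀ s : p, e • s = 0 := by
        let ψ : p →ₗ[R] p :=
          { toFun := fun s => e • s
            map_add' := smul_add e
            map_smul' := fun r s => by
              rw [RingHom.id_apply, ← mul_smul, ← mul_smul, hec r] }
        rcases LinearMap.bijective_or_eq_zero ψ with h | h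
        · refine absurd (fun s => ?_) hep
          apply h.1
          change e • e • s = e • s
          rw [← mul_smul, he.idem.eq]
        · exact fun s => LinearMap.congr_fun h s
      have : Algebra.lsmul F F p (x * e) = 0 := by
        ext s
        simp [h0]
      rw [hsum, hm, this, map_zero, zero_add]

/-- Over a semisimple algebra, the traces of any two modules are proportional on the block of a
primitive central idempotent. -/
theorem exists_trace_eq_mul_trace [CharZero F] [FiniteDimensional F R] {e : R}
    (he : IsPrimitiveIdempotent (Subring.center R) e)
    {M : Type*} [AddCommGroup M] [Module F M] [Module R M] [IsScalarTower F R M]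
    [FiniteDimensional F M] :
    ∃ c : F, ∀ x : R, LinearMap.trace F M (Algebra.lsmul F F M (x * e)) =
      c * LinearMap.trace F R (Algebra.lsmul F F R (x * e)) := by
  have hec := Subring.mem_center_iff.1 he.mem
  have hmem : e ∈ Ideal.span {e} := Ideal.subset_span rfl
  rcases IsSemisimpleModule.eq_bot_or_exists_simple_le (R := R) (M := R)
    (Ideal.span {e}) with h | ⟨S, hle, hS⟩
  · exact absurd ((Submodule.mem_bot R).1 (h ▸ hmem)) he.ne_zero
  have heS : ∀ s : S, e • s = s := by
    intro s
    obtain ⟨a, ha⟩ := Ideal.mem_span_singleton'.1 (hle s.2)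
    refine Subtype.ext ?_
    change e * (s : R) = s
    rw [← ha, ← hec, mul_assoc, he.idem.eq]
  obtain ⟨m, hm⟩ := exists_nat_trace_eq (F := F) he S heS (M := M)
  obtain ⟨n, hn⟩ := exists_nat_trace_eq (F := F) he S heS (M := R)
  -- If the multiplicity in the regular module were zero, left multiplication by `e` would be an
  -- idempotent of trace zero; in characteristic zero this forces `e = 0`.
  have hn0 : (n : F) ≠ 0 := by
    intro h0
    have h1 := hn 1
    rw [h0, zero_mul, one_mul] at h1
    have hidem : IsIdempotentElem (Algebra.lsmul F F R e) := he.idem.map _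
    have h2 := LinearMap.congr_fun (LinearMap.IsIdempotentElem.eq_zero_of_trace_eq_zero hidem h1) 1
    exact he.ne_zero (by simpa using h2)
  refine ⟨m / n, fun x => ?_⟩
  rw [hm, hn]
  field_simp

/-- The traces of `a ↦ φ (x e) a q` on an algebra `A` over a semisimple algebra `R` are proportional
to the regular trace of `R` on the block of a primitive central idempotent `e`. -/
theorem exists_trace_mulLeftRight_eq [CharZero F] [FiniteDimensional F R] {e : R}
    (he : IsPrimitiveIdempotent (Subring.center R) e)
    {A : Type*} [Ring A] [Algebra F A] [FiniteDimensional F A] (φ : R →ₐ[F] A) {q : A}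
    (hq : IsIdempotentElem q) :
    ∃ c : F, ∀ x : R, LinearMap.trace F A (LinearMap.mulLeftRight F (φ (x * e), q)) =
      c * LinearMap.trace F R (LinearMap.mulLeft F (x * e)) := by
  let _ : Module R A := Module.compHom A (φ : R →+* A)
  have hsmul : ∀ (r : R) (a : A), r • a = φ r * a := fun _ _ => rfl
  have : IsScalarTower F R A := ⟨fun r x a => by simp only [hsmul, map_smul, smul_mul_assoc]⟩
  -- The left module `A q`. The operator maps all of `A` into `V`, so its trace may be computed
  -- there, and right multiplication by `q` is the identity on `V`.
  let V : Submodule R A :=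
    { carrier := {a | a * q = a}
      zero_mem' := zero_mul q
      add_mem' := fun {a b} ha hb => by
        change (a + b) * q = a + b
        rw [add_mul, show a * q = a from ha, show b * q = b from hb]
      smul_mem' := fun r a ha => by
        change r • a * q = r • a
        rw [hsmul, mul_assoc, show a * q = a from ha] }
  have : FiniteDimensional F V := inferInstanceAs (FiniteDimensional F (V.restrictScalars F))
  obtain ⟨c, hc⟩ := exists_trace_eq_mul_trace (F := F) he (M := V)
  refine ⟨c, fun x => ?_⟩
  have hV : ∀ a, LinearMap.mulLeftRight F (φ (x * e), q) a ∈ V.restrictScalars F := by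
    intro a
    change φ (x * e) * a * q * q = φ (x * e) * a * q
    rw [mul_assoc, hq.eq]
  rw [← LinearMap.trace_restrict_eq_of_forall_mem (V.restrictScalars F) _ hV (fun a _ => hV a)]
  refine Eq.trans ?_ (hc x)
  change LinearMap.trace F V _ = _
  congr 1
  ext a
  change φ (x * e) * (a : A) * q = φ (x * e) * (a : A)
  rw [mul_assoc, show (a : A) * q = a from a.2]

end Semisimple

/-! ### Primitive idempotents of commutative subrings -/

section Primitive

variable {A : Type*} [Ring A] {C : Subring A}

/-- An idempotent `e` of `C` cuts `p` into the orthogonal idempotents `p e` and `p - p e`, one of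
which must vanish. -/
theorem IsPrimitiveIdempotent.mul_eq_zero_or_mul_eq (hC : ∀ x ∈ C, ∀ y ∈ C, x * y = y * x) {p e : A}
    (hp : IsPrimitiveIdempotent C p) (he : e ∈ C) (hi : IsIdempotentElem e) :
    p * e = 0 ∨ p * e = p := by
  have hpe := hC p hp.mem e he
  have h1 : IsIdempotentElem (p * e) := hp.idem.mul_of_commute hpe hi
  have h2 : p * e * p = p * e := by rw [mul_assoc, ← hpe, ← mul_assoc, hp.idem.eq]
  have h3 : p * (p * e) = p * e := by rw [← mul_assoc, hp.idem.eq]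
  have h4 : IsIdempotentElem (p - p * e) := by
    rw [IsIdempotentElem, mul_sub, sub_mul, sub_mul, h1.eq, h2, h3, hp.idem.eq]; abel
  have h5 : p * e * (p - p * e) = 0 := by rw [mul_sub, h1.eq, h2, sub_self]
  have hm := C.mul_mem hp.mem he
  rcases hp.primitive _ hm _ (C.sub_mem hp.mem hm) h1 h4 h5 (by abel) with h | h
  · exact Or.inl h
  · exact Or.inr (sub_eq_zero.1 h).symm

theorem IsPrimitiveIdempotent.eq_of_mul_ne_zero (hC : ∀ x ∈ C, ∀ y ∈ C, x * y = y * x) {p q : A}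
    (hp : IsPrimitiveIdempotent C p) (hq : IsPrimitiveIdempotent C q) (h : p * q ≠ 0) : p = q := by
  have h1 := (hp.mul_eq_zero_or_mul_eq hC hq.mem hq.idem).resolve_left h
  rw [hC p hp.mem q hq.mem] at h h1
  have h2 := (hq.mul_eq_zero_or_mul_eq hC hp.mem hp.idem).resolve_left h
  exact h1.symm.trans h2

/-- Induction on `dim e A`: a nonprimitive nonzero `e` splits into two orthogonal nonzero
idempotents, each generating a strictly smaller right ideal. -/
theorem mem_closure_primitive (F : Type*) [Field F] [Algebra F A] [FiniteDimensional F A] {e : A}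
    (he : e ∈ C) (hi : IsIdempotentElem e) :
    e ∈ AddSubmonoid.closure {p | IsPrimitiveIdempotent C p} := by
  induction hn : Module.finrank F (LinearMap.range (LinearMap.mulLeft F e)) using
    Nat.strong_induction_on generalizing e with
  | _ n ih =>
    by_cases h0 : e = 0
    · rw [h0]; exact zero_mem _
    by_cases hp : IsPrimitiveIdempotent C e
    · exact AddSubmonoid.subset_closure hp
    have hex : ∃ e₁ ∈ C, ∃ e₂ ∈ C, IsIdempotentElem e₁ ∧ IsIdempotentElem e₂ ∧ e₁ * e₂ = 0 ∧
        e = e₁ + e₂ ∧ e₁ ≠ 0 ∧ e₂ ≠ 0 := by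
      by_contra hno
      refine hp ⟨he, hi, h0, fun e₁ h₁ e₂ h₂ hi₁ hi₂ h12 hsum => ?_⟩
      by_contra hne
      push Not at hne
      exact hno ⟨e₁, h₁, e₂, h₂, hi₁, hi₂, h12, hsum, hne⟩
    obtain ⟨e₁, h₁, e₂, h₂, hi₁, hi₂, h12, rfl, hne₁, hne₂⟩ := hex
    have h21 : e₂ * e₁ = 0 := by
      have h := hi.eq
      rw [mul_add, add_mul, add_mul, hi₁.eq, hi₂.eq, h12, zero_add] at h
      have h3 : e₂ * e₁ = (e₁ + e₂ * e₁ + e₂) - (e₁ + e₂) := by abel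
      rw [h3, h, sub_self]
    have key : ∀ a b : A, IsIdempotentElem a → IsIdempotentElem b → a * b = 0 → b * a = 0 →
        b ≠ 0 → Module.finrank F (LinearMap.range (LinearMap.mulLeft F a)) <
          Module.finrank F (LinearMap.range (LinearMap.mulLeft F (a + b))) := by
      intro a b ha hb hab hba hb0
      refine Submodule.finrank_lt_finrank_of_lt (lt_of_le_not_ge ?_ fun hle => hb0 ?_)
      · rintro _ ⟨x, rfl⟩
        refine ⟨a * x, ?_⟩
        rw [LinearMap.mulLeft_apply, LinearMap.mulLeft_apply, ← mul_assoc, add_mul, ha.eq, hba,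
          add_zero]
      -- If `a + b = a x`, left multiplication by `b` gives `b = b a x = 0`.
      · obtain ⟨x, hx⟩ := hle ⟨1, rfl⟩
        rw [LinearMap.mulLeft_apply, LinearMap.mulLeft_apply, mul_one] at hx
        have := congrArg (b * ·) hx
        simp only [← mul_assoc, hba, zero_mul, mul_add, hb.eq, zero_add] at this
        exact this.symm
    refine add_mem (ih _ ?_ h₁ hi₁ rfl) (ih _ ?_ h₂ hi₂ rfl)
    · rw [← hn]; exact key _ _ hi₁ hi₂ h12 h21 hne₂
    · rw [← hn, add_comm]; exact key _ _ hi₂ hi₁ h21 h12 hne₁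

/-- Used to pass between `K[D]` as an abstract group ring, where Maschke's theorem applies, and its
copy inside `ℂ[G]`, and also for conjugation by elements of `G`. -/
theorem isPrimitiveIdempotent_map_iff {B : Type*} [Ring B] {φ : A →+* B}
    (hφ : Function.Injective φ) {p : A} :
    IsPrimitiveIdempotent (C.map φ) (φ p) ↔ IsPrimitiveIdempotent C p := by
  have hid : ∀ x, IsIdempotentElem (φ x) ↔ IsIdempotentElem x := fun x => by
    rw [IsIdempotentElem, ← map_mul, hφ.eq_iff, IsIdempotentElem]
  have h0 : ∀ x, φ x = 0 ↔ x = 0 := fun x => map_eq_zero_iff φ hφ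
  constructor
  · intro h
    obtain ⟨x, hx, hxp⟩ := h.mem
    refine ⟨hφ hxp ▸ hx, (hid p).1 h.idem, fun hp => h.ne_zero ((h0 p).2 hp), ?_⟩
    intro e₁ h₁ e₂ h₂ i₁ i₂ h12 hs
    rw [← h0, ← h0]
    exact h.primitive _ ⟨e₁, h₁, rfl⟩ _ ⟨e₂, h₂, rfl⟩ ((hid _).2 i₁) ((hid _).2 i₂)
      (by rw [← map_mul, h12, map_zero]) (by rw [hs, map_add])
  · intro h
    refine ⟨⟨p, h.mem, rfl⟩, (hid p).2 h.idem, fun hp => h.ne_zero ((h0 p).1 hp), ?_⟩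
    rintro _ ⟨e₁, h₁, rfl⟩ _ ⟨e₂, h₂, rfl⟩ i₁ i₂ h12 hs
    rw [h0, h0]
    exact h.primitive _ h₁ _ h₂ ((hid _).1 i₁) ((hid _).1 i₂)
      ((h0 _).1 (by rw [map_mul, h12])) (hφ (by rw [hs, map_add]))

end Primitive

/-! ### Group rings of finite groups -/

section GroupRing

theorem trace_monoidAlgebra {F : Type*} [Field F] {X : Type*} [Fintype X]
    (f : MonoidAlgebra F X →ₗ[F] MonoidAlgebra F X) :
    LinearMap.trace F _ f = ∑ x, (f (MonoidAlgebra.single x 1)).coeff x := by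
  classical
  rw [LinearMap.trace_eq_matrix_trace F (MonoidAlgebra.basis X F), Matrix.trace]
  refine Finset.sum_congr rfl fun x _ => ?_
  rw [Matrix.diag_apply, LinearMap.toMatrix_apply]
  rfl

theorem finiteDimensional_monoidAlgebra (F : Type*) [Field F] (X : Type*) [Finite X] :
    FiniteDimensional F (MonoidAlgebra F X) :=
  Module.Finite.of_basis (MonoidAlgebra.basis X F)

variable {G : Type*} [Group G] (F : Type*) [Field F] [Algebra F ℂ]

/-- The inclusion `F[H] → ℂ[G]` of group rings for `H ≤ G` and `F ⊆ ℂ`. -/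
def extend (H : Subgroup G) : MonoidAlgebra F H →+* MonoidAlgebra ℂ G :=
  (MonoidAlgebra.mapRingHom G (algebraMap F ℂ)).comp (MonoidAlgebra.mapDomainRingHom F H.subtype)

theorem extend_single (H : Subgroup G) (h : H) (r : F) :
    extend F H (MonoidAlgebra.single h r) = MonoidAlgebra.single (h : G) (algebraMap F ℂ r) := by
  simp [extend]

theorem coeff_extend (H : Subgroup G) (x : MonoidAlgebra F H) (h : H) :
    (extend F H x).coeff h = algebraMap F ℂ (x.coeff h) := by
  change algebraMap F ℂ ((Finsupp.mapDomain H.subtype x.coeff) (H.subtype h)) = _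
  rw [Finsupp.mapDomain_apply H.subtype_injective]

theorem coeff_extend_of_notMem (H : Subgroup G) (x : MonoidAlgebra F H) {g : G} (hg : g ∉ H) :
    (extend F H x).coeff g = 0 := by
  change algebraMap F ℂ ((Finsupp.mapDomain H.subtype x.coeff) g) = _
  rw [Finsupp.mapDomain_of_notMem_range _ _ (by simpa using hg), map_zero]

theorem extend_injective (H : Subgroup G) : Function.Injective (extend F H) := by
  intro x y hxy
  ext h
  apply (algebraMap F ℂ).injective
  rw [← coeff_extend, hxy, coeff_extend]

theorem mem_range_extend (H : Subgroup G) [Finite H] (y : MonoidAlgebra ℂ G) :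
    y ∈ (extend F H).range ↔
      (∀ g, y.coeff g ∈ (algebraMap F ℂ).range) ∧ ∀ g, y.coeff g ≠ 0 → g ∈ H := by
  constructor
  · rintro ⟨x, rfl⟩
    refine ⟨fun g => ?_, fun g hg => by_contra fun h => hg (coeff_extend_of_notMem F H x h)⟩
    by_cases hg : g ∈ H
    · exact ⟨_, (coeff_extend F H x ⟨g, hg⟩).symm⟩
    · rw [coeff_extend_of_notMem F H x hg]; exact zero_mem _
  · rintro ⟨h1, h2⟩
    choose c hc using h1
    refine ⟨.ofCoeff (Finsupp.equivFunOnFinite.symm fun h => c h), ?_⟩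
    ext g
    by_cases hg : g ∈ H
    · rw [coeff_extend F H _ ⟨g, hg⟩]
      exact hc g
    · rw [coeff_extend_of_notMem F H _ hg]
      by_contra h
      exact hg (h2 g (Ne.symm h))

theorem range_extend (K : Subfield ℂ) (H : Subgroup G) [Finite H] :
    (extend K H).range = subgroupRing K H := by
  ext y
  rw [mem_range_extend]
  refine and_congr (forall_congr' fun g => ?_) Iff.rfl
  constructor
  · rintro ⟨c, hc⟩
    exact hc ▸ c.2
  · exact fun h => ⟨⟨_, h⟩, rfl⟩

theorem map_center_extend (K : Subfield ℂ) (H : Subgroup G) [Finite H] :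
    (Subring.center (MonoidAlgebra K H)).map (extend K H) = subgroupRing K H ⊓
      Subring.centralizer (subgroupRing K H : Set (MonoidAlgebra ℂ G)) := by
  ext y
  rw [Subring.mem_inf, Subring.mem_centralizer_iff, ← range_extend]
  constructor
  · rintro ⟨x, hx, rfl⟩
    refine ⟨⟨x, rfl⟩, ?_⟩
    rintro _ ⟨z, rfl⟩
    rw [← map_mul, ← map_mul, Subring.mem_center_iff.1 hx]
  · rintro ⟨⟨x, rfl⟩, h⟩
    refine ⟨x, Subring.mem_center_iff.2 fun z => extend_injective K H ?_, rfl⟩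
    rw [map_mul, map_mul]
    exact h _ ⟨z, rfl⟩

theorem coeff_single_mul_mul_single {k M : Type*} [Semiring k] [Group M] (x : MonoidAlgebra k M)
    (a b g : M) :
    (MonoidAlgebra.single a 1 * x * MonoidAlgebra.single b 1).coeff g =
      x.coeff (a⁻¹ * g * b⁻¹) := by
  rw [MonoidAlgebra.coeff_mul_single_apply, MonoidAlgebra.coeff_single_mul_apply, one_mul, mul_one,
    mul_assoc]

/-- On the block of a primitive central idempotent `q` of `K[D]`, the character of the
`K[D]`-module `K[H] Q` is proportional to `q`. -/
theorem exists_character_eq (K : Subfield ℂ) {D H : Subgroup G} [Finite D] [Fintype H] (hDH : D ≤ H)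
    {Q : MonoidAlgebra ℂ G} (hQ : Q ∈ subgroupRing K H) (hQi : IsIdempotentElem Q)
    {q : MonoidAlgebra ℂ G} (hq : IsPrimitiveIdempotent (subgroupRing K D ⊓
      Subring.centralizer (subgroupRing K D : Set (MonoidAlgebra ℂ G))) q) :
    ∃ c : ℂ, ∀ d ∈ D, ∑ h : H, (MonoidAlgebra.single d 1 * q * MonoidAlgebra.single (h : G) 1 *
      Q).coeff (h : G) = c * q.coeff d⁻¹ := by
  have := Fintype.ofFinite D
  have := finiteDimensional_monoidAlgebra K D
  have := finiteDimensional_monoidAlgebra K H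
  rw [← map_center_extend] at hq
  obtain ⟨q', -, rfl⟩ := hq.mem
  rw [isPrimitiveIdempotent_map_iff (extend_injective K D)] at hq
  rw [← range_extend] at hQ
  obtain ⟨Q', rfl⟩ := hQ
  have hQi' : IsIdempotentElem Q' := extend_injective K H (by rw [map_mul]; exact hQi.eq)
  let j : MonoidAlgebra K D →ₐ[K] MonoidAlgebra K H :=
    MonoidAlgebra.mapDomainAlgHom K K (Subgroup.inclusion hDH)
  have hj : ∀ x, extend K H (j x) = extend K D x := by
    intro x
    induction x using MonoidAlgebra.induction_linear with
    | zero => simp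
    | add x y hx hy => rw [map_add, map_add, map_add, hx, hy]
    | single d r => simp [j, extend_single]
  obtain ⟨c, hc⟩ := exists_trace_mulLeftRight_eq hq j hQi'
  -- The regular trace of `d q` has `|D|` diagonal entries, all equal to the coefficient of `q` at
  -- `d⁻¹`; this accounts for the factor `|D|`.
  refine ⟨(c * Fintype.card D : K), fun d hd => ?_⟩
  have h1 := hc (MonoidAlgebra.single ⟨d, hd⟩ 1)
  rw [trace_monoidAlgebra, trace_monoidAlgebra] at h1
  have h2 : ∀ b : D, (LinearMap.mulLeft K (MonoidAlgebra.single (⟨d, hd⟩ : D) 1 * q')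
      (MonoidAlgebra.single b 1)).coeff b = q'.coeff ⟨d, hd⟩⁻¹ := by
    intro b
    rw [LinearMap.mulLeft_apply, coeff_single_mul_mul_single, mul_assoc, mul_inv_cancel, mul_one]
  simp only [h2, Finset.sum_const, Finset.card_univ, nsmul_eq_mul] at h1
  have h3 : (extend K D q').coeff d⁻¹ = algebraMap K ℂ (q'.coeff ⟨d, hd⟩⁻¹) :=
    coeff_extend K D q' ⟨d, hd⟩⁻¹
  rw [h3]
  change _ = algebraMap K ℂ (c * Fintype.card D) * _
  rw [← map_mul, mul_assoc, ← h1, map_sum]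
  refine Finset.sum_congr rfl fun h _ => ?_
  rw [← coeff_extend, LinearMap.mulLeftRight_apply, map_mul, map_mul, hj, map_mul, extend_single,
    extend_single, map_one]

end GroupRing

/-! ### The group ring inside the group von Neumann algebra -/

section GroupRingNG

variable {G : Type*} [Group G]

theorem fourier_groupRingToNG (x : MonoidAlgebra ℂ G) (g : G) :
    fourier (groupRingToNG G x : L2 G →L[ℂ] L2 G) g = x.coeff g := by
  classical
  induction x using MonoidAlgebra.induction_linear with
  | zero => rw [map_zero]; rfl
  | add x y hx hy =>
    rw [map_add, MonoidAlgebra.coeff_add, Finsupp.add_apply, ← hx, ← hy]; rfl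
  | single h r =>
    rw [groupRingToNG, MonoidAlgebra.lift_single]
    change r * (leftRegular G h (delta 1)) g = _
    rw [leftRegular_delta, delta_apply, MonoidAlgebra.coeff_single, Finsupp.single_apply, mul_one]
    simp [eq_comm]

theorem groupRingToNG_injective : Function.Injective (groupRingToNG G) := by
  intro x y hxy
  ext g
  rw [← fourier_groupRingToNG, hxy, fourier_groupRingToNG]

theorem fourier_star (T : NG G) (g : G) :
    fourier ((star T : NG G) : L2 G →L[ℂ] L2 G) g =
      starRingEnd ℂ (fourier (T : L2 G →L[ℂ] L2 G) g⁻¹) := by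
  change (ContinuousLinearMap.adjoint (T : L2 G →L[ℂ] L2 G)) (delta 1) g = _
  rw [← inner_delta, ContinuousLinearMap.adjoint_inner_right, ← inner_conj_symm, inner_delta,
    NG_delta, one_mul]

/-- The adjoint `∑ x_g g ↦ ∑ conj(x_g) g⁻¹` of the complex group ring. -/
def adj (x : MonoidAlgebra ℂ G) : MonoidAlgebra ℂ G :=
  .ofCoeff ((x.coeff.mapRange (starRingEnd ℂ) (map_zero _)).equivMapDomain (Equiv.inv G))

theorem coeff_adj (x : MonoidAlgebra ℂ G) (g : G) :
    (adj x).coeff g = starRingEnd ℂ (x.coeff g⁻¹) := rfl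

theorem groupRingToNG_adj (x : MonoidAlgebra ℂ G) :
    groupRingToNG G (adj x) = star (groupRingToNG G x) :=
  fourier_injective fun g => by
    rw [fourier_star, fourier_groupRingToNG, fourier_groupRingToNG, coeff_adj]

theorem adj_mul (x y : MonoidAlgebra ℂ G) : adj (x * y) = adj y * adj x :=
  groupRingToNG_injective (by simp only [map_mul, groupRingToNG_adj, star_mul])

theorem adj_adj (x : MonoidAlgebra ℂ G) : adj (adj x) = x :=
  groupRingToNG_injective (by simp only [groupRingToNG_adj, star_star])

theorem adj_add (x y : MonoidAlgebra ℂ G) : adj (x + y) = adj x + adj y :=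
  groupRingToNG_injective (by simp only [map_add, groupRingToNG_adj, star_add])

theorem adj_zero : adj (0 : MonoidAlgebra ℂ G) = 0 :=
  groupRingToNG_injective (by simp only [map_zero, groupRingToNG_adj, star_zero])

theorem adj_mem_subgroupRing {K : Subfield ℂ} (hK : ∀ z ∈ K, starRingEnd ℂ z ∈ K) {H : Subgroup G}
    {x : MonoidAlgebra ℂ G} (hx : x ∈ subgroupRing K H) : adj x ∈ subgroupRing K H := by
  refine ⟨fun g => hK _ (hx.1 _), fun g hg => inv_mem_iff.1 (hx.2 _ fun h => hg ?_)⟩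
  rw [coeff_adj, h, map_zero]

theorem isStarProjection_groupRingToNG_iff {x : MonoidAlgebra ℂ G} :
    IsStarProjection (groupRingToNG G x) ↔ IsIdempotentElem x ∧ adj x = x := by
  rw [isStarProjection_iff, IsIdempotentElem, IsIdempotentElem, IsSelfAdjoint, ← groupRingToNG_adj,
    ← map_mul, groupRingToNG_injective.eq_iff, groupRingToNG_injective.eq_iff]

/-- The C*-identity for operators on `ℓ²(G)`, transported along the injection of `ℂ[G]` into `𝓝(G)`.
-/
theorem eq_zero_of_mul_adj_self {x : MonoidAlgebra ℂ G} (h : x * adj x = 0) : x = 0 := by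
  have h1 := congrArg (groupRingToNG G) h
  rw [map_mul, groupRingToNG_adj, map_zero] at h1
  have h2 := congrArg (Subtype.val : NG G → L2 G →L[ℂ] L2 G) h1
  have h3 := (CStarRing.mul_star_self_eq_zero_iff (groupRingToNG G x : L2 G →L[ℂ] L2 G)).1 h2
  exact groupRingToNG_injective (by rw [map_zero]; exact Subtype.ext h3)

/-- For a projection `T`, `⟨δ, T δ⟩ = ⟨δ, T T δ⟩ = ⟨T δ, T δ⟩`. So the coefficient at `1` is real,
and it is nonzero unless the projection is zero. -/
theorem coeff_one_eq_norm {x : MonoidAlgebra ℂ G} (hx : IsStarProjection (groupRingToNG G x)) :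
    x.coeff 1 = ((‖(groupRingToNG G x : L2 G →L[ℂ] L2 G) (delta 1)‖ ^ 2 : ℝ) : ℂ) := by
  set T := (groupRingToNG G x : L2 G →L[ℂ] L2 G) with hT
  have hs : ContinuousLinearMap.adjoint T = T := congrArg Subtype.val hx.isSelfAdjoint.star_eq
  have hi : T * T = T := congrArg Subtype.val hx.isIdempotentElem.eq
  rw [← fourier_groupRingToNG, fourier, ← inner_delta, ← hT]
  nth_rw 1 [← hi]
  change inner ℂ (delta 1) (T (T (delta 1))) = _
  rw [← ContinuousLinearMap.adjoint_inner_left, hs,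
    inner_self_eq_norm_sq_to_K]
  norm_cast

theorem coeff_one_ne_zero {x : MonoidAlgebra ℂ G} (hx : IsStarProjection (groupRingToNG G x))
    (h0 : x ≠ 0) : x.coeff 1 ≠ 0 := by
  intro h
  apply h0
  rw [coeff_one_eq_norm hx] at h
  have h1 : (groupRingToNG G x : L2 G →L[ℂ] L2 G) (delta 1) = 0 := by simpa using h
  ext g
  rw [← fourier_groupRingToNG, fourier, h1]; rfl

/-- The range of a projection is already closed, so the orthogonal projection in the definition of
the dimension is the operator of `x` itself. -/
theorem vnDim_leftImage {x : MonoidAlgebra ℂ G} (hx : IsStarProjection (groupRingToNG G x)) :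
    ((vnDim (leftImage x) : ℝ) : ℂ) = x.coeff 1 := by
  have hT : IsStarProjection (groupRingToNG G x : L2 G →L[ℂ] L2 G) :=
    ⟨congrArg Subtype.val hx.isIdempotentElem.eq, congrArg Subtype.val hx.isSelfAdjoint.star_eq⟩
  obtain ⟨_, h⟩ := isStarProjection_iff_eq_starProjection_range.1 hT
  have hcl : IsClosed (leftImage x : Set (L2 G)) :=
    ContinuousLinearMap.IsIdempotentElem.isClosed_range hT.isIdempotentElem
  have h2 : (leftImage x).topologicalClosure = leftImage x := hcl.submodule_topologicalClosure_eq
  have h3 : (leftImage x).topologicalClosure.starProjection =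
      (groupRingToNG G x : L2 G →L[ℂ] L2 G) := by
    rw [h]
    congr 1
  rw [vnDim, h3, canonicalTrace, inner_delta, ← fourier, fourier_groupRingToNG, coeff_one_eq_norm hx,
    Complex.ofReal_re]

theorem subgroupRing_top (H : Subgroup G) [Finite H] :
    subgroupRing (⊤ : Subfield ℂ) H = (extend ℂ H).range := by
  ext y
  rw [mem_range_extend]
  exact and_congr (forall_congr' fun g => ⟨fun _ => ⟨_, rfl⟩, fun _ => trivial⟩) Iff.rfl

/-- The dimension is the trace of left multiplication by the idempotent `x` on `ℂ[H]`, and each of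
its `|H|` diagonal entries is the coefficient of `x` at `1`. -/
theorem idealDim_eq (H : Subgroup G) [Finite H] {x : MonoidAlgebra ℂ G}
    (hx : x ∈ subgroupRing (⊤ : Subfield ℂ) H) (hi : IsIdempotentElem x) :
    (idealDim x H : ℂ) = Nat.card H * x.coeff 1 := by
  have := Fintype.ofFinite H
  have := finiteDimensional_monoidAlgebra ℂ H
  rw [subgroupRing_top] at hx
  obtain ⟨x, rfl⟩ := hx
  have hi' : IsIdempotentElem x := extend_injective ℂ H (by rw [map_mul]; exact hi.eq)
  let j : MonoidAlgebra ℂ H →ₗ[ℂ] MonoidAlgebra ℂ G :=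
    { extend ℂ H with
      map_smul' := fun r y => by
        change extend ℂ H (r • y) = r • extend ℂ H y
        ext g
        by_cases hg : g ∈ H
        · rw [MonoidAlgebra.coeff_smul, Finsupp.smul_apply, coeff_extend ℂ H _ ⟨g, hg⟩,
            coeff_extend ℂ H _ ⟨g, hg⟩]; simp
        · rw [MonoidAlgebra.coeff_smul, Finsupp.smul_apply, coeff_extend_of_notMem ℂ H _ hg,
            coeff_extend_of_notMem ℂ H _ hg, smul_zero] }
  have hj : Function.Injective j := extend_injective ℂ H
  have hspan : Submodule.span ℂ ((fun y => extend ℂ H x * y) ''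
      (subgroupRing ⊤ H : Set (MonoidAlgebra ℂ G))) =
      (LinearMap.range (LinearMap.mulLeft ℂ x)).map j := by
    rw [← Submodule.span_eq ((LinearMap.range (LinearMap.mulLeft ℂ x)).map j)]
    congr 1
    ext y
    rw [subgroupRing_top]
    constructor
    · rintro ⟨_, ⟨z, rfl⟩, rfl⟩
      exact ⟨_, ⟨z, rfl⟩, map_mul (extend ℂ H) x z⟩
    · rintro ⟨_, ⟨z, rfl⟩, rfl⟩
      exact ⟨_, ⟨z, rfl⟩, (map_mul (extend ℂ H) x z).symm⟩
  have hid : IsIdempotentElem (LinearMap.mulLeft ℂ x) := by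
    refine LinearMap.ext fun y => ?_
    change x * (x * y) = x * y
    rw [← mul_assoc, hi'.eq]
  rw [idealDim, hspan, ← (Submodule.equivMapOfInjective j hj _).finrank_eq,
    ← (LinearMap.IsIdempotentElem.isProj_range _ hid).trace, trace_monoidAlgebra]
  have hc : ∀ h : H, (LinearMap.mulLeft ℂ x (MonoidAlgebra.single h 1)).coeff h =
      (extend ℂ H x).coeff 1 := by
    intro h
    rw [LinearMap.mulLeft_apply, MonoidAlgebra.coeff_mul_single_apply, mul_inv_cancel, mul_one]
    exact (coeff_extend ℂ H x 1).symm
  simp only [hc, Finset.sum_const, Finset.card_univ, nsmul_eq_mul, Nat.card_eq_fintype_card]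

/-! ### Conjugation on the group ring -/

/-- Conjugation by `g` on the complex group ring. -/
def conjRing (g : G) : MonoidAlgebra ℂ G →+* MonoidAlgebra ℂ G where
  toFun x := MonoidAlgebra.single g 1 * x * MonoidAlgebra.single g⁻¹ 1
  map_zero' := by simp
  map_one' := by simp [MonoidAlgebra.one_def]
  map_add' x y := by rw [mul_add, add_mul]
  map_mul' x y := by
    have h : (MonoidAlgebra.single g⁻¹ 1 : MonoidAlgebra ℂ G) * MonoidAlgebra.single g 1 = 1 := by
      simp [MonoidAlgebra.one_def]
    calc _ = MonoidAlgebra.single g 1 * x * 1 * y * MonoidAlgebra.single g⁻¹ 1 := by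
            rw [mul_one, mul_assoc _ x y]
      _ = _ := by rw [← h]; simp only [mul_assoc]

theorem coeff_conjRing (g : G) (x : MonoidAlgebra ℂ G) (h : G) :
    (conjRing g x).coeff h = x.coeff (g⁻¹ * h * g) := by
  change (MonoidAlgebra.single g 1 * x * MonoidAlgebra.single g⁻¹ 1).coeff h = _
  rw [coeff_single_mul_mul_single, inv_inv]

theorem conjRing_mul (g h : G) (x : MonoidAlgebra ℂ G) :
    conjRing (g * h) x = conjRing g (conjRing h x) := by
  ext y
  simp only [coeff_conjRing]
  congr 1
  group

theorem conjRing_one (x : MonoidAlgebra ℂ G) : conjRing 1 x = x := by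
  ext y
  simp [coeff_conjRing]

theorem conjRing_injective (g : G) : Function.Injective (conjRing g) :=
  Function.LeftInverse.injective (g := conjRing g⁻¹) fun x => by
    rw [← conjRing_mul, inv_mul_cancel, conjRing_one]

/-- An element of `𝓝(G)` is central exactly when its Fourier coefficients are constant on conjugacy
classes. -/
theorem groupRingToNG_mem_center_iff {x : MonoidAlgebra ℂ G} :
    groupRingToNG G x ∈ Subalgebra.center ℂ (NG G) ↔ ∀ g, conjRing g x = x := by
  constructor
  · intro h g
    ext y
    rw [coeff_conjRing, ← fourier_groupRingToNG, fourier_of_mem_center h, fourier_groupRingToNG]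
  · intro h
    refine mem_center_of_fourier fun g y => ?_
    rw [fourier_groupRingToNG, fourier_groupRingToNG, ← coeff_conjRing, h]

theorem mul_comm_of_conjRing_eq {x : MonoidAlgebra ℂ G} (hx : ∀ g, conjRing g x = x)
    (y : MonoidAlgebra ℂ G) : y * x = x * y :=
  groupRingToNG_injective (by
    rw [map_mul, map_mul, Subalgebra.mem_center_iff.1 (groupRingToNG_mem_center_iff.2 hx)])

/-! ### Elements of finite order with finitely many conjugates -/

theorem conjRing_mem_subgroupRing {K : Subfield ℂ} {N : Subgroup G} (hN : N.Normal) (g : G)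
    {x : MonoidAlgebra ℂ G} (hx : x ∈ subgroupRing K N) : conjRing g x ∈ subgroupRing K N := by
  refine ⟨fun h => ?_, fun h hh => ?_⟩
  · rw [coeff_conjRing]; exact hx.1 _
  · rw [coeff_conjRing] at hh
    have := hN.conj_mem _ (hx.2 _ hh) g
    simpa [mul_assoc] using this

open scoped IsMulCommutative in
/-- A group generated by finitely many elements of finite order whose centre has finite index is
finite. -/
theorem finite_of_closure_torsion {N : Type*} [Group N] [(Subgroup.center N).FiniteIndex] {X : Set N}
    (hX : X.Finite) (hgen : Subgroup.closure X = ⊤) (ht : ∀ x ∈ X, IsOfFinOrder x) : Finite N := by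
  have hfg : Group.FG N := Group.fg_iff.2 ⟨X, hgen, hX⟩
  -- The transfer into the centre is the homomorphism `y ↦ y ^ [N : Z(N)]`. The generators land in
  -- the torsion subgroup of the abelian group `Z(N)`, hence so does everything, and `N` is torsion.
  -- The centre, being finitely generated, abelian and torsion, is finite.
  let φ := MonoidHom.transferCenterPow N
  have htor : ∀ y : N, IsOfFinOrder y := by
    intro y
    have hle : Subgroup.closure X ≤ (CommGroup.torsion (Subgroup.center N)).comap φ := by
      rw [Subgroup.closure_le]
      exact fun x hx => MonoidHom.isOfFinOrder φ (ht x hx)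
    have hy : IsOfFinOrder (φ y) := hle (hgen ▸ Subgroup.mem_top y)
    have h2 : IsOfFinOrder (y ^ (Subgroup.center N).index) :=
      MonoidHom.isOfFinOrder (Subgroup.center N).subtype hy
    exact (isOfFinOrder_pow.1 h2).resolve_right Subgroup.FiniteIndex.index_ne_zero
  have hfin : Finite (Subgroup.center N) :=
    CommGroup.finite_of_fg_isMulTorsion _ fun y =>
      (Function.Injective.isOfFinOrder_iff (f := (Subgroup.center N).subtype)
        Subtype.val_injective).1 (htor y)
  exact (Subgroup.finite_iff_finite_and_finiteIndex (Subgroup.center N)).2 ⟨hfin, inferInstance⟩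

/-- `N` acts on the finite set `X` by conjugation, and an element acting trivially centralizes the
generating set, so it is central. Hence `N / Z(N)` embeds in the self-maps of `X`. -/
theorem finiteIndex_center_of_closure {N : Type*} [Group N] {X : Set N} (hX : X.Finite)
    (hconj : ∀ n, ∀ x ∈ X, n * x * n⁻¹ ∈ X) (hgen : Subgroup.closure X = ⊤) :
    (Subgroup.center N).FiniteIndex := by
  have := hX.to_subtype
  let f : N ⧸ Subgroup.center N → X → X := fun a x => ⟨a.out * x * a.out⁻¹, hconj _ _ x.2⟩
  have hf : Function.Injective f := by
    intro a b hab
    rw [← Quotient.out_eq a, ← Quotient.out_eq b]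
    refine QuotientGroup.eq.2 (Subgroup.mem_center_iff.2 fun y => ?_)
    have hle : Subgroup.closure X ≤ Subgroup.centralizer {a.out⁻¹ * b.out} := by
      rw [Subgroup.closure_le]
      intro x hx
      rw [SetLike.mem_coe, Subgroup.mem_centralizer_singleton_iff]
      have h1 : a.out * x * a.out⁻¹ = b.out * x * b.out⁻¹ :=
        congrArg Subtype.val (congrFun hab ⟨x, hx⟩)
      calc x * (a.out⁻¹ * b.out) = a.out⁻¹ * (a.out * x * a.out⁻¹) * b.out := by group
        _ = a.out⁻¹ * b.out * x := by rw [h1]; group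
    exact Subgroup.mem_centralizer_singleton_iff.1 (hle (hgen ▸ Subgroup.mem_top y))
  have := Finite.of_injective f hf
  exact Subgroup.finiteIndex_of_finite_quotient

/-- Dietzmann's lemma: an element of finite order with finitely many conjugates lies in a finite
normal subgroup. -/
theorem mem_deltaPlus {g : G} (hfin : (conjugatesOf g).Finite) (ht : IsOfFinOrder g) :
    g ∈ deltaPlus G := by
  let N := Subgroup.normalClosure {g}
  have hN : N = Subgroup.closure (conjugatesOf g) := by
    change Subgroup.closure (Group.conjugatesOfSet {g}) = _
    rw [Group.conjugatesOfSet, Set.biUnion_singleton]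
  have hgN : g ∈ N := Subgroup.subset_normalClosure rfl
  let X : Set N := Subtype.val ⁻¹' conjugatesOf g
  have hX : X.Finite := hfin.preimage Subtype.val_injective.injOn
  have hgen : Subgroup.closure X = ⊤ := by
    have h := Subgroup.closure_closure_coe_preimage (k := conjugatesOf g)
    rw [← hN] at h
    exact h
  have hc : (Subgroup.center N).FiniteIndex := by
    refine finiteIndex_center_of_closure hX (fun n x hx => ?_) hgen
    exact IsConj.trans (b := (x : G)) hx (isConj_iff.2 ⟨n, rfl⟩)
  have hf : Finite N := finite_of_closure_torsion hX hgen fun x hx => by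
    rw [← Function.Injective.isOfFinOrder_iff (f := N.subtype) Subtype.val_injective]
    obtain ⟨c, hc⟩ := isConj_iff.1 (show IsConj g (x : G) from hx)
    have := MonoidHom.isOfFinOrder (MulAut.conj c).toMonoidHom ht
    rw [show (MulAut.conj c).toMonoidHom g = x from hc] at this
    exact this
  exact le_sSup (a := N) (s := {N : Subgroup G | N.Normal ∧ Finite N})
    ⟨Subgroup.normalClosure_normal, hf⟩ hgN

theorem deltaPlus_normal : (deltaPlus G).Normal := by
  refine ⟨fun n hn g => ?_⟩
  rw [← SetLike.mem_coe] at hn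
  have hle : deltaPlus G ≤ (deltaPlus G).comap (MulAut.conj g).toMonoidHom := by
    refine sSup_le fun N hN x hx => ?_
    exact le_sSup (a := N) (s := {N : Subgroup G | N.Normal ∧ Finite N}) hN (hN.1.conj_mem x hx g)
  exact hle hn

end GroupRingNG

/-! ### Orbit sums of primitive central idempotents -/

section OrbitSum

variable {G : Type*} [Group G] {K : Subfield ℂ}

theorem deltaCenter_comm : ∀ x ∈ deltaCenter G K, ∀ y ∈ deltaCenter G K, x * y = y * x :=
  fun x hx _ hy => Subring.mem_centralizer_iff.1 hy.2 x hx.1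

theorem conjRing_mem_deltaCenter (g : G) {x : MonoidAlgebra ℂ G} (hx : x ∈ deltaCenter G K) :
    conjRing g x ∈ deltaCenter G K := by
  refine ⟨conjRing_mem_subgroupRing deltaPlus_normal g hx.1,
    Subring.mem_centralizer_iff.2 fun y hy => ?_⟩
  have h := Subring.mem_centralizer_iff.1 hx.2 _
    (conjRing_mem_subgroupRing deltaPlus_normal g⁻¹ hy)
  have h2 := congrArg (conjRing g) h
  rwa [map_mul, map_mul, ← conjRing_mul, mul_inv_cancel, conjRing_one] at h2

theorem map_conjRing_deltaCenter (g : G) :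
    (deltaCenter G K).map (conjRing g) = deltaCenter G K := by
  ext x
  constructor
  · rintro ⟨y, hy, rfl⟩
    exact conjRing_mem_deltaCenter g hy
  · intro hx
    exact ⟨conjRing g⁻¹ x, conjRing_mem_deltaCenter g⁻¹ hx, by
      rw [← conjRing_mul, mul_inv_cancel, conjRing_one]⟩

theorem isPrimitiveIdempotent_conjRing (g : G) {p : MonoidAlgebra ℂ G}
    (hp : IsPrimitiveIdempotent (deltaCenter G K) p) :
    IsPrimitiveIdempotent (deltaCenter G K) (conjRing g p) := by
  rw [← map_conjRing_deltaCenter g, isPrimitiveIdempotent_map_iff (conjRing_injective g)]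
  exact hp

theorem adj_mem_deltaCenter (hK : ∀ z ∈ K, starRingEnd ℂ z ∈ K) {x : MonoidAlgebra ℂ G}
    (hx : x ∈ deltaCenter G K) : adj x ∈ deltaCenter G K := by
  refine ⟨adj_mem_subgroupRing hK hx.1, Subring.mem_centralizer_iff.2 fun y hy => ?_⟩
  have h := Subring.mem_centralizer_iff.1 hx.2 _ (adj_mem_subgroupRing hK hy)
  have h2 := congrArg adj h
  rw [adj_mul, adj_mul, adj_adj] at h2
  exact h2.symm

/-- The adjoint `p*` is again an idempotent of the centre, so `p p*` is `0` or `p`. The C*-identity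
excludes `0`, and `p = p p*` is self-adjoint. -/
theorem IsPrimitiveIdempotent.adj_eq (hK : ∀ z ∈ K, starRingEnd ℂ z ∈ K) {p : MonoidAlgebra ℂ G}
    (hp : IsPrimitiveIdempotent (deltaCenter G K) p) : adj p = p := by
  have hi : IsIdempotentElem (adj p) := by rw [IsIdempotentElem, ← adj_mul, hp.idem.eq]
  have h := (hp.mul_eq_zero_or_mul_eq deltaCenter_comm (adj_mem_deltaCenter hK hp.mem)
    hi).resolve_left fun h => hp.ne_zero (eq_zero_of_mul_adj_self h)
  calc adj p = adj (p * adj p) := by rw [h]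
    _ = p * adj p := by rw [adj_mul, adj_adj]
    _ = p := h

theorem mem_conjugates_iff {p q : MonoidAlgebra ℂ G} :
    q ∈ conjugates p ↔ ∃ g, conjRing g p = q :=
  exists_congr fun _ => eq_comm

theorem self_mem_conjugates (p : MonoidAlgebra ℂ G) : p ∈ conjugates p :=
  mem_conjugates_iff.2 ⟨1, conjRing_one p⟩

theorem isPrimitiveIdempotent_of_mem_conjugates {p q : MonoidAlgebra ℂ G}
    (hp : IsPrimitiveIdempotent (deltaCenter G K) p) (hq : q ∈ conjugates p) :
    IsPrimitiveIdempotent (deltaCenter G K) q := by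
  obtain ⟨g, rfl⟩ := mem_conjugates_iff.1 hq
  exact isPrimitiveIdempotent_conjRing g hp

theorem conjRing_mem_conjugates (g : G) {p q : MonoidAlgebra ℂ G} (hq : q ∈ conjugates p) :
    conjRing g q ∈ conjugates p := by
  obtain ⟨h, rfl⟩ := mem_conjugates_iff.1 hq
  exact mem_conjugates_iff.2 ⟨g * h, conjRing_mul g h p⟩

theorem conjugates_eq_of_mem {p q : MonoidAlgebra ℂ G} (hq : q ∈ conjugates p) :
    conjugates q = conjugates p := by
  refine Set.Subset.antisymm (fun r hr => ?_) fun r hr => ?_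
  · obtain ⟨g, rfl⟩ := mem_conjugates_iff.1 hr
    exact conjRing_mem_conjugates g hq
  · obtain ⟨g, rfl⟩ := mem_conjugates_iff.1 hr
    obtain ⟨h, rfl⟩ := mem_conjugates_iff.1 hq
    exact mem_conjugates_iff.2 ⟨g * h⁻¹, by rw [← conjRing_mul, inv_mul_cancel_right]⟩

variable [Finite (deltaPlus G)]

theorem one_mem_closure_primitive (K : Subfield ℂ) : (1 : MonoidAlgebra ℂ G) ∈
    AddSubmonoid.closure {p | IsPrimitiveIdempotent (deltaCenter G K) p} := by
  have := finiteDimensional_monoidAlgebra K (deltaPlus G)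
  have h1 := mem_closure_primitive (C := Subring.center (MonoidAlgebra K (deltaPlus G))) K
    (one_mem _) IsIdempotentElem.one
  have h2 := AddSubmonoid.mem_map_of_mem (extend K (deltaPlus G)).toAddMonoidHom h1
  rw [AddMonoidHom.map_mclosure] at h2
  have h3 := AddSubmonoid.closure_mono (t := {p | IsPrimitiveIdempotent (deltaCenter G K) p}) (by
    rintro _ ⟨p, hp, rfl⟩
    change IsPrimitiveIdempotent (deltaCenter G K) (extend K (deltaPlus G) p)
    rw [deltaCenter, ← map_center_extend, isPrimitiveIdempotent_map_iff (extend_injective _ _)]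
    exact hp) h2
  rwa [show (extend K (deltaPlus G)).toAddMonoidHom 1 = 1 from map_one (extend K (deltaPlus G))] at h3

/-- Write `1` as a finite sum of primitive idempotents. Since `p = p · 1 ≠ 0`, some summand has
nonzero product with `p` and therefore equals `p`. -/
theorem finite_primitive (K : Subfield ℂ) :
    {p : MonoidAlgebra ℂ G | IsPrimitiveIdempotent (deltaCenter G K) p}.Finite := by
  obtain ⟨l, hl, hsum⟩ := AddSubmonoid.exists_multiset_of_mem_closure
    (one_mem_closure_primitive (G := G) K)
  refine (Multiset.finite_toSet l).subset fun p hp => ?_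
  by_contra hpl
  apply hp.ne_zero
  have hmul : p * l.sum = (l.map (p * ·)).sum := by
    rw [Multiset.sum_map_mul_left, Multiset.map_id']
  rw [← mul_one p, ← hsum, hmul]
  refine Multiset.sum_eq_zero fun y hy => ?_
  obtain ⟨q, hq, rfl⟩ := Multiset.mem_map.1 hy
  by_contra hne
  exact hpl (hp.eq_of_mul_ne_zero deltaCenter_comm (hl q hq) hne ▸ hq)

theorem finite_conjugates {p : MonoidAlgebra ℂ G}
    (hp : IsPrimitiveIdempotent (deltaCenter G K) p) : (conjugates p).Finite :=
  (finite_primitive K).subset fun _ => isPrimitiveIdempotent_of_mem_conjugates hp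

/-- The sum of the distinct conjugates of `p`. -/
def orbitSum (p : MonoidAlgebra ℂ G) : MonoidAlgebra ℂ G := ∑ᶠ q ∈ conjugates p, q

variable {p : MonoidAlgebra ℂ G} (hp : IsPrimitiveIdempotent (deltaCenter G K) p)

include hp

theorem orbitSum_eq : orbitSum p = ∑ q ∈ (finite_conjugates hp).toFinset, q :=
  finsum_mem_eq_finite_toFinset_sum _ _

theorem mul_orbitSum_of_mem {q : MonoidAlgebra ℂ G} (hq : q ∈ conjugates p) :
    q * orbitSum p = q := by
  have hq' := isPrimitiveIdempotent_of_mem_conjugates hp hq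
  rw [orbitSum_eq hp, Finset.mul_sum, Finset.sum_eq_single q, hq'.idem.eq]
  · intro r hr hrq
    by_contra hne
    exact hrq (hq'.eq_of_mul_ne_zero deltaCenter_comm (isPrimitiveIdempotent_of_mem_conjugates hp
      ((finite_conjugates hp).mem_toFinset.1 hr)) hne).symm
  · exact fun h => absurd ((finite_conjugates hp).mem_toFinset.2 hq) h

theorem orbitSum_mem : orbitSum p ∈ deltaCenter G K := by
  rw [orbitSum_eq hp]
  exact sum_mem fun q hq => (isPrimitiveIdempotent_of_mem_conjugates hp
    ((finite_conjugates hp).mem_toFinset.1 hq)).mem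

theorem isIdempotentElem_orbitSum : IsIdempotentElem (orbitSum p) := by
  rw [IsIdempotentElem]
  nth_rw 1 [orbitSum_eq hp]
  rw [Finset.sum_mul]
  nth_rw 2 [orbitSum_eq hp]
  exact Finset.sum_congr rfl fun q hq =>
    mul_orbitSum_of_mem hp ((finite_conjugates hp).mem_toFinset.1 hq)

theorem orbitSum_ne_zero : orbitSum p ≠ 0 := by
  intro h
  have := mul_orbitSum_of_mem hp (self_mem_conjugates p)
  rw [h, mul_zero] at this
  exact hp.ne_zero this.symm

theorem conjRing_orbitSum (g : G) : conjRing g (orbitSum p) = orbitSum p := by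
  rw [orbitSum_eq hp, map_sum]
  refine Finset.sum_bij' (fun q _ => conjRing g q) (fun q _ => conjRing g⁻¹ q) ?_ ?_ ?_ ?_ ?_
  · intro q hq
    rw [Set.Finite.mem_toFinset] at hq ⊢
    exact conjRing_mem_conjugates g hq
  · intro q hq
    rw [Set.Finite.mem_toFinset] at hq ⊢
    exact conjRing_mem_conjugates g⁻¹ hq
  · intro q _
    rw [← conjRing_mul, inv_mul_cancel, conjRing_one]
  · intro q _
    rw [← conjRing_mul, mul_inv_cancel, conjRing_one]
  · intro q _; rfl

theorem isStarProjection_orbitSum (hK : ∀ z ∈ K, starRingEnd ℂ z ∈ K) :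
    IsStarProjection (groupRingToNG G (orbitSum p)) := by
  refine isStarProjection_groupRingToNG_iff.2 ⟨isIdempotentElem_orbitSum hp, ?_⟩
  let φ : MonoidAlgebra ℂ G →+ MonoidAlgebra ℂ G :=
    { toFun := adj, map_zero' := adj_zero, map_add' := adj_add }
  change φ (orbitSum p) = orbitSum p
  rw [orbitSum_eq hp, map_sum]
  exact Finset.sum_congr rfl fun q hq => (isPrimitiveIdempotent_of_mem_conjugates hp
    ((finite_conjugates hp).mem_toFinset.1 hq)).adj_eq hK

omit [Finite (deltaPlus G)] hp in
theorem mem_invariantCenter_iff {x : MonoidAlgebra ℂ G} :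
    x ∈ invariantCenter G K ↔ x ∈ deltaCenter G K ∧ ∀ g, conjRing g x = x :=
  and_congr Iff.rfl groupRingToNG_mem_center_iff

/-- A conjugation-invariant element annihilated by one conjugate of `p` is annihilated by all of
them, hence by their sum. In a splitting `P = e₁ + e₂`, primitivity of `p` makes `p e₁` or `p e₂`
zero, so the corresponding `eᵢ = P eᵢ` vanishes. -/
theorem isPrimitiveIdempotent_orbitSum :
    IsPrimitiveIdempotent (invariantCenter G K) (orbitSum p) := by
  have key : ∀ e ∈ invariantCenter G K, p * e = 0 → orbitSum p * e = 0 := by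
    intro e he hpe
    rw [orbitSum_eq hp, Finset.sum_mul]
    refine Finset.sum_eq_zero fun q hq => ?_
    obtain ⟨g, rfl⟩ := mem_conjugates_iff.1 ((finite_conjugates hp).mem_toFinset.1 hq)
    rw [← (mem_invariantCenter_iff.1 he).2 g, ← map_mul, hpe, map_zero]
  refine ⟨mem_invariantCenter_iff.2 ⟨orbitSum_mem hp, conjRing_orbitSum hp⟩,
    isIdempotentElem_orbitSum hp, orbitSum_ne_zero hp, fun e₁ h₁ e₂ h₂ i₁ i₂ h12 hs => ?_⟩
  have c₁ := (mem_invariantCenter_iff.1 h₁).1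
  have c₂ := (mem_invariantCenter_iff.1 h₂).1
  have h21 : e₂ * e₁ = 0 := by rw [deltaCenter_comm _ c₂ _ c₁, h12]
  rcases hp.mul_eq_zero_or_mul_eq deltaCenter_comm c₁ i₁ with h | h
  · left
    have := key e₁ h₁ h
    rwa [hs, add_mul, i₁.eq, h21, add_zero] at this
  · right
    have h' : p * e₂ = 0 := by rw [← h, mul_assoc, h12, mul_zero]
    have := key e₂ h₂ h'
    rwa [hs, add_mul, h12, i₂.eq, zero_add] at this

/-- Orbit sums of non-conjugate primitive central idempotents are orthogonal. -/
theorem orbitSum_mul_orbitSum_of_ne {p' : MonoidAlgebra ℂ G}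
    (hp' : IsPrimitiveIdempotent (deltaCenter G K) p') (h : orbitSum p ≠ orbitSum p') :
    orbitSum p * orbitSum p' = 0 := by
  rw [orbitSum_eq hp, orbitSum_eq hp', Finset.sum_mul_sum]
  refine Finset.sum_eq_zero fun q hq => Finset.sum_eq_zero fun r hr => ?_
  rw [Set.Finite.mem_toFinset] at hq hr
  by_contra hne
  have hqr := (isPrimitiveIdempotent_of_mem_conjugates hp hq).eq_of_mul_ne_zero deltaCenter_comm
    (isPrimitiveIdempotent_of_mem_conjugates hp' hr) hne
  apply h
  rw [orbitSum, orbitSum, ← conjugates_eq_of_mem hq, hqr, conjugates_eq_of_mem hr]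

end OrbitSum

/-! ### The centre-valued trace of an irreducible projection -/

section CenterTrace

variable {G : Type*} [Group G] {K : Subfield ℂ}

theorem subgroupRing_mono {H H' : Subgroup G} (h : H ≤ H') {x : MonoidAlgebra ℂ G}
    (hx : x ∈ subgroupRing K H) : x ∈ subgroupRing K H' :=
  ⟨hx.1, fun g hg => h (hx.2 g hg)⟩

/-- As `P` is central, `Q = Q P + (Q - Q P)` is a decomposition into orthogonal projections of
`K[H]`. -/
theorem IsIrreducibleProjection.mul_eq_zero_or_mul_eq {H : Subgroup G} {Q P : MonoidAlgebra ℂ G}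
    (hQ : IsIrreducibleProjection K H Q) (hP : IsProjectionIn K H P)
    (hc : ∀ g, conjRing g P = P) : Q * P = 0 ∨ Q * P = Q := by
  have hcomm := mul_comm_of_conjRing_eq hc Q
  obtain ⟨hQi, hQa⟩ := isStarProjection_groupRingToNG_iff.1 hQ.isProjectionIn.2
  obtain ⟨hPi, hPa⟩ := isStarProjection_groupRingToNG_iff.1 hP.2
  have hQP : IsStarProjection (groupRingToNG G (Q * P)) := by
    rw [map_mul]
    exact hQ.isProjectionIn.2.mul hP.2 (by rw [Commute, SemiconjBy, ← map_mul, ← map_mul, hcomm])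
  have hQPQ : Q * P * Q = Q * P := by rw [mul_assoc, ← hcomm, ← mul_assoc, hQi.eq]
  have hdiff : IsStarProjection (groupRingToNG G (Q - Q * P)) := by
    rw [map_sub]
    exact hQP.sub_of_mul_eq_left hQ.isProjectionIn.2 (by rw [← map_mul, hQPQ])
  have hm := (subgroupRing K H).mul_mem hQ.isProjectionIn.1 hP.1
  have horth : Q * P * (Q - Q * P) = 0 := by
    rw [mul_sub, hQPQ, (isStarProjection_groupRingToNG_iff.1 hQP).1.eq, sub_self]
  rcases hQ.irreducible _ _ ⟨hm, hQP⟩ ⟨(subgroupRing K H).sub_mem hQ.isProjectionIn.1 hm, hdiff⟩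
    (by abel) horth with h | h
  · exact Or.inl h
  · exact Or.inr (sub_eq_zero.1 h).symm

variable (G) in
/-- The centre-valued trace on the group ring, as a linear map to `𝓝(G)`. -/
def ringTrace : MonoidAlgebra ℂ G →ₗ[ℂ] NG G :=
  (Subalgebra.center ℂ (NG G)).val.toLinearMap ∘ₗ centerTrace G ∘ₗ (groupRingToNG G).toLinearMap

theorem ringTrace_apply (x : MonoidAlgebra ℂ G) :
    ringTrace G x = (centerTrace G (groupRingToNG G x) : NG G) := rfl

theorem fourier_ringTrace (x : MonoidAlgebra ℂ G) (g : G) :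
    fourier (ringTrace G x : L2 G →L[ℂ] L2 G) g =
      classAverage (fourier (groupRingToNG G x : L2 G →L[ℂ] L2 G)) g :=
  fourier_centerTrace _ g

theorem ringTrace_conjRing (g : G) (x : MonoidAlgebra ℂ G) :
    ringTrace G (conjRing g x) = ringTrace G x := by
  refine fourier_injective fun y => ?_
  have h : fourier (groupRingToNG G (conjRing g x) : L2 G →L[ℂ] L2 G) =
      fun z => fourier (groupRingToNG G x : L2 G →L[ℂ] L2 G) (g⁻¹ * z * g) := by
    ext z
    rw [fourier_groupRingToNG, fourier_groupRingToNG, coeff_conjRing]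
  rw [fourier_ringTrace, fourier_ringTrace, h, classAverage_conj]

theorem ringTrace_of_conjRing_eq {x : MonoidAlgebra ℂ G} (hx : ∀ g, conjRing g x = x) :
    ringTrace G x = groupRingToNG G x :=
  congrArg Subtype.val
    (centerTrace_isCenterValuedTrace.center ⟨_, groupRingToNG_mem_center_iff.2 hx⟩)

/-- The centre-valued trace kills the elements of `ℂ[H]`, for `H` finite, that vanish on `Δ⁺`. -/
theorem ringTrace_eq_zero {H : Subgroup G} [Finite H] {x : MonoidAlgebra ℂ G}
    (hH : ∀ g, x.coeff g ≠ 0 → g ∈ H) (hD : ∀ g ∈ deltaPlus G, x.coeff g = 0) :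
    ringTrace G x = 0 := by
  refine fourier_injective fun g => ?_
  rw [fourier_ringTrace]
  change _ = (0 : ℂ)
  by_cases hg : (conjugatesOf g).Finite
  · rw [classAverage_of_finite hg, Finset.sum_eq_zero, zero_div]
    intro y hy
    rw [fourier_groupRingToNG]
    by_contra hne
    -- A class member `y` in the support has a finite class and, lying in the finite group `H`,
    -- finite order, so Dietzmann's lemma applies.
    refine hne (hD y (mem_deltaPlus ?_ ?_))
    · rwa [← isConj_iff_conjugatesOf_eq.1 (hg.mem_toFinset.1 hy)]
    · exact MonoidHom.isOfFinOrder H.subtype (isOfFinOrder_of_finite (⟨y, hH y hne⟩ : H))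
  · exact classAverage_of_infinite hg _

theorem ringTrace_eq_of_coeff_eq {H : Subgroup G} [Finite H] {x y : MonoidAlgebra ℂ G}
    (hx : ∀ g, x.coeff g ≠ 0 → g ∈ H) (hy : ∀ g, y.coeff g ≠ 0 → g ∈ H)
    (hxy : ∀ g ∈ deltaPlus G, x.coeff g = y.coeff g) :
    ringTrace G x = ringTrace G y := by
  rw [← sub_eq_zero, ← map_sub]
  refine ringTrace_eq_zero (H := H) (fun g hg => ?_) fun g hg => ?_
  · by_contra hgH
    rw [MonoidAlgebra.coeff_sub, Finsupp.sub_apply, not_imp_comm.1 (hx g) hgH,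
      not_imp_comm.1 (hy g) hgH, sub_zero] at hg
    exact hg rfl
  · rw [MonoidAlgebra.coeff_sub, Finsupp.sub_apply, hxy g hg, sub_self]

variable [Finite (deltaPlus G)]

/-- All conjugates share one trace, and these traces add up to that of the orbit sum, which is
central and so equals its own trace. -/
theorem ringTrace_primitive {p q : MonoidAlgebra ℂ G}
    (hp : IsPrimitiveIdempotent (deltaCenter G K) p) (hq : q ∈ conjugates p) :
    ringTrace G q =
      ((conjugates p).ncard : ℂ)⁻¹ • groupRingToNG G (orbitSum p) := by
  have hcard : (conjugates p).ncard = (finite_conjugates hp).toFinset.card :=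
    Set.ncard_eq_toFinset_card _ _
  have h0 : ((conjugates p).ncard : ℂ) ≠ 0 := by
    exact_mod_cast Set.ncard_ne_zero_of_mem hq (finite_conjugates hp)
  rw [← ringTrace_of_conjRing_eq (conjRing_orbitSum hp)]
  have h1 : ∀ r ∈ (finite_conjugates hp).toFinset,
      ringTrace G r = ringTrace G q := by
    intro r hr
    rw [Set.Finite.mem_toFinset, ← conjugates_eq_of_mem hq] at hr
    obtain ⟨g, rfl⟩ := mem_conjugates_iff.1 hr
    exact ringTrace_conjRing g q
  have h2 : ringTrace G (orbitSum p) =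
      ((conjugates p).ncard : ℂ) • ringTrace G q := by
    rw [orbitSum_eq hp, map_sum, Finset.sum_congr rfl h1, Finset.sum_const, hcard,
      Nat.cast_smul_eq_nsmul]
  rw [h2, smul_smul, inv_mul_cancel₀ h0, one_smul]

theorem exists_ringTrace_eq_smul {H : Subgroup G} [Finite H] (hH : deltaPlus G ≤ H)
    {Q p : MonoidAlgebra ℂ G} (hQ : Q ∈ subgroupRing K H) (hQi : IsIdempotentElem Q)
    (hp : IsPrimitiveIdempotent (deltaCenter G K) p) (hQP : Q * orbitSum p = Q) :
    ∃ c : ℂ, ringTrace G Q = c • groupRingToNG G (orbitSum p) := by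
  have := Fintype.ofFinite H
  have hS := fun q hq => isPrimitiveIdempotent_of_mem_conjugates (q := q) hp
    ((finite_conjugates hp).mem_toFinset.1 hq)
  have hex := fun q (hq : q ∈ (finite_conjugates hp).toFinset) =>
    exists_character_eq K hH hQ hQi (hS q hq)
  choose! c hc using hex
  have hcent := mul_comm_of_conjRing_eq (conjRing_orbitSum hp)
  set S := (finite_conjugates hp).toFinset
  have hsum : ∀ d ∈ deltaPlus G, (∑ h : H, conjRing (h : G) Q).coeff d =
      (∑ q ∈ S, c q • q).coeff d := by
    intro d hd
    -- The coefficient of `h Q h⁻¹` at `d` is that of `d⁻¹ h Q` at `h`. Since `P` is central and `Q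
    -- P = Q`, the factor `P = ∑ q` can be inserted before `h`; summed over `h`, each term becomes a
    -- trace handled by `exists_character_eq`.
    have h1 : ∀ h : H, (conjRing (h : G) Q).coeff d = ∑ q ∈ S, (MonoidAlgebra.single d⁻¹ 1 * q *
        MonoidAlgebra.single (h : G) 1 * Q).coeff (h : G) := by
      intro h
      rw [← Finsupp.finsetSum_apply, ← MonoidAlgebra.coeff_sum, ← Finset.sum_mul, ← Finset.sum_mul,
        ← Finset.mul_sum, ← orbitSum_eq hp, mul_assoc _ (orbitSum p), ← hcent, mul_assoc, mul_assoc,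
        ← hcent Q, hQP, MonoidAlgebra.coeff_single_mul_apply, MonoidAlgebra.coeff_single_mul_apply,
        one_mul, one_mul, inv_inv, coeff_conjRing, mul_assoc]
    rw [MonoidAlgebra.coeff_sum, Finsupp.finsetSum_apply, MonoidAlgebra.coeff_sum,
      Finsupp.finsetSum_apply, Finset.sum_congr rfl fun h _ => h1 h, Finset.sum_comm]
    refine Finset.sum_congr rfl fun q hq => ?_
    rw [hc q hq _ (inv_mem hd), inv_inv, MonoidAlgebra.coeff_smul, Finsupp.smul_apply, smul_eq_mul]
  have htr : ringTrace G (∑ h : H, conjRing (h : G) Q) =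
      ringTrace G (∑ q ∈ S, c q • q) := by
    refine ringTrace_eq_of_coeff_eq (H := H) (fun g hg => ?_) (fun g hg => ?_) hsum
    · rw [MonoidAlgebra.coeff_sum, Finsupp.finsetSum_apply] at hg
      obtain ⟨h, -, hh⟩ := Finset.exists_ne_zero_of_sum_ne_zero hg
      rw [coeff_conjRing] at hh
      have hm := hQ.2 _ hh
      have h2 := H.mul_mem (H.mul_mem h.2 hm) (H.inv_mem h.2)
      rwa [show (h : G) * ((h : G)⁻¹ * g * h) * (h : G)⁻¹ = g by group] at h2
    · rw [MonoidAlgebra.coeff_sum, Finsupp.finsetSum_apply] at hg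
      obtain ⟨q, hq, hh⟩ := Finset.exists_ne_zero_of_sum_ne_zero hg
      rw [MonoidAlgebra.coeff_smul, Finsupp.smul_apply] at hh
      exact hH ((hS q hq).mem.1.2 g (right_ne_zero_of_smul hh))
  have hcardH : (Fintype.card H : ℂ) ≠ 0 := by exact_mod_cast Fintype.card_ne_zero
  have hleft : ringTrace G (∑ h : H, conjRing (h : G) Q) =
      (Fintype.card H : ℂ) • ringTrace G Q := by
    simp only [map_sum, ringTrace_conjRing, Finset.sum_const, Finset.card_univ,
      Nat.cast_smul_eq_nsmul]
  have hright : ringTrace G (∑ q ∈ S, c q • q) =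
      (∑ q ∈ S, c q * ((conjugates p).ncard : ℂ)⁻¹) • groupRingToNG G (orbitSum p) := by
    rw [map_sum, Finset.sum_smul]
    refine Finset.sum_congr rfl fun q hq => ?_
    rw [map_smul, mul_smul, ← ringTrace_primitive hp ((finite_conjugates hp).mem_toFinset.1 hq)]
  refine ⟨(Fintype.card H : ℂ)⁻¹ * ∑ q ∈ S, c q * ((conjugates p).ncard : ℂ)⁻¹, ?_⟩
  rw [mul_smul, ← hright, ← htr, hleft, smul_smul, inv_mul_cancel₀ hcardH, one_smul]

-- The class of `1` is a singleton, so averaging does not change this coefficient. This determines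
-- the scalar in `ringTrace_eq_smul`.
omit [Finite (deltaPlus G)] in
theorem fourier_ringTrace_one (x : MonoidAlgebra ℂ G) :
    fourier (ringTrace G x : L2 G →L[ℂ] L2 G) 1 = x.coeff 1 := by
  have h1 : conjugatesOf (1 : G) = {1} := by
    ext y
    rw [Set.mem_singleton_iff]
    exact isConj_one_right
  have hf : (conjugatesOf (1 : G)).Finite := by rw [h1]; exact Set.finite_singleton 1
  have h2 : hf.toFinset = {1} := by ext y; simp [h1]
  rw [fourier_ringTrace, classAverage_of_finite hf, h2, Finset.sum_singleton, h1,
    Set.ncard_singleton, fourier_groupRingToNG, Nat.cast_one, div_one]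

/-- `tr^u(Q) = (Q(1) / P(1)) P`. -/
theorem ringTrace_eq_smul {H : Subgroup G} [Finite H] (hK : ∀ z ∈ K, starRingEnd ℂ z ∈ K)
    (hH : deltaPlus G ≤ H)
    {Q p : MonoidAlgebra ℂ G} (hQ : Q ∈ subgroupRing K H) (hQi : IsIdempotentElem Q)
    (hp : IsPrimitiveIdempotent (deltaCenter G K) p) (hQP : Q * orbitSum p = Q) :
    ringTrace G Q =
      (Q.coeff 1 / (orbitSum p).coeff 1) • groupRingToNG G (orbitSum p) := by
  obtain ⟨c, hc⟩ := exists_ringTrace_eq_smul hH hQ hQi hp hQP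
  have h1 := fourier_ringTrace_one Q
  rw [hc] at h1
  change c * fourier (groupRingToNG G (orbitSum p) : L2 G →L[ℂ] L2 G) 1 = _ at h1
  rw [fourier_groupRingToNG] at h1
  rw [hc, ← h1, mul_div_cancel_right₀ _ (coeff_one_ne_zero (isStarProjection_orbitSum hp hK)
    (orbitSum_ne_zero hp))]

/-- If `Q` annihilated every orbit sum, then, each primitive `p` being a multiple of its orbit sum,
it would annihilate every `p`, hence `1`. -/
theorem exists_mul_orbitSum_eq {H : Subgroup G} (hK : ∀ z ∈ K, starRingEnd ℂ z ∈ K)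
    (hH : deltaPlus G ≤ H) {Q : MonoidAlgebra ℂ G} (hQ : IsIrreducibleProjection K H Q) :
    ∃ p, IsPrimitiveIdempotent (deltaCenter G K) p ∧ Q * orbitSum p = Q := by
  by_contra hno
  push Not at hno
  apply hQ.ne_zero
  have h : ∀ y ∈ AddSubmonoid.closure {p | IsPrimitiveIdempotent (deltaCenter G K) p},
      Q * y = 0 := by
    intro y hy
    induction hy using AddSubmonoid.closure_induction with
    | mem p hp =>
      have h0 := (hQ.mul_eq_zero_or_mul_eq ⟨subgroupRing_mono hH (orbitSum_mem hp).1,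
        isStarProjection_orbitSum hp hK⟩ (conjRing_orbitSum hp)).resolve_right (hno p hp)
      rw [← mul_orbitSum_of_mem hp (self_mem_conjugates p),
        ← deltaCenter_comm _ (orbitSum_mem hp) _ hp.mem, ← mul_assoc, h0, zero_mul]
    | zero => rw [mul_zero]
    | add x y _ _ hx hy => rw [mul_add, hx, hy, add_zero]
  rw [← mul_one Q, h 1 (one_mem_closure_primitive K)]

end CenterTrace

end GroupVN

end

/-! ### Location of the trace, uniqueness of `P`, and the two dimension formulas. -/

theorem mainTheorem8 {G : Type*} [Group G]
    (hG : ∃ N : ℕ, ∀ F : Subgroup G, Finite F → Nat.card F ≤ N)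
    (K : Subfield ℂ) (hK : ∀ z ∈ K, starRingEnd ℂ z ∈ K)
    (H : Subgroup G) (hHfin : Finite H) (hH : GroupVN.deltaPlus G ≤ H)
    (Q : MonoidAlgebra ℂ G) (hQ : GroupVN.IsIrreducibleProjection K H Q) :
    (GroupVN.centerTrace G (GroupVN.groupRingToNG G Q) : GroupVN.NG G) ∈
        GroupVN.groupRingToNG G '' (GroupVN.invariantCenter G K : Set (MonoidAlgebra ℂ G)) ∧
    (∃! P : MonoidAlgebra ℂ G, P ∈ GroupVN.centralProjections G K ∧ Q * P = Q) ∧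
    ∀ P ∈ GroupVN.centralProjections G K, Q * P = Q →
      IsStarProjection (GroupVN.groupRingToNG G P) ∧
      GroupVN.IsPrimitiveIdempotent (GroupVN.invariantCenter G K) P ∧
      (GroupVN.centerTrace G (GroupVN.groupRingToNG G Q) : GroupVN.NG G) =
        ((((GroupVN.idealDim Q H : ℚ) * (Nat.card (GroupVN.deltaPlus G) : ℚ)) /
          ((Nat.card H : ℚ) * (GroupVN.idealDim P (GroupVN.deltaPlus G) : ℚ)) : ℚ) : ℂ) •
            GroupVN.groupRingToNG G P ∧
      (GroupVN.centerTrace G (GroupVN.groupRingToNG G Q) : GroupVN.NG G) =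
        ((GroupVN.vnDim (GroupVN.leftImage Q) / GroupVN.vnDim (GroupVN.leftImage P) : ℝ) : ℂ) •
            GroupVN.groupRingToNG G P := by
  have : Finite (GroupVN.deltaPlus G) := Finite.of_injective _ (Subgroup.inclusion_injective hH)
  have hQm := hQ.isProjectionIn.1
  have hQi := (GroupVN.isStarProjection_groupRingToNG_iff.1 hQ.isProjectionIn.2).1
  have htop : ∀ {L : Subgroup G} {x : MonoidAlgebra ℂ G}, x ∈ GroupVN.subgroupRing K L →
      x ∈ GroupVN.subgroupRing (⊤ : Subfield ℂ) L := fun hx => ⟨fun _ => trivial, hx.2⟩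
  obtain ⟨p, hp, hQp⟩ := GroupVN.exists_mul_orbitSum_eq hK hH hQ
  refine ⟨?_, ⟨GroupVN.orbitSum p, ⟨⟨p, hp, rfl⟩, hQp⟩, ?_⟩, ?_⟩
  · rw [← GroupVN.ringTrace_apply, GroupVN.ringTrace_eq_smul hK hH hQm hQi hp hQp, ← map_smul]
    refine ⟨_, GroupVN.mem_invariantCenter_iff.2 ⟨?_, fun g => ?_⟩, rfl⟩
    -- Both coefficients lie in `K`, so the multiple of `P` stays in `K[Δ⁺]` and not merely in
    -- `ℂ[Δ⁺]`.
    · have hc : Q.coeff 1 / (GroupVN.orbitSum p).coeff 1 ∈ K :=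
        K.div_mem (hQm.1 1) ((GroupVN.orbitSum_mem hp).1.1 1)
      refine ⟨⟨fun g => ?_, fun g hg => ?_⟩, Subring.mem_centralizer_iff.2 fun y hy => ?_⟩
      · rw [MonoidAlgebra.coeff_smul, Finsupp.smul_apply, smul_eq_mul]
        exact K.mul_mem hc ((GroupVN.orbitSum_mem hp).1.1 g)
      · rw [MonoidAlgebra.coeff_smul, Finsupp.smul_apply] at hg
        exact (GroupVN.orbitSum_mem hp).1.2 g (right_ne_zero_of_smul hg)
      · rw [mul_smul_comm, smul_mul_assoc,
          Subring.mem_centralizer_iff.1 (GroupVN.orbitSum_mem hp).2 y hy]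
    · ext y
      rw [GroupVN.coeff_conjRing, MonoidAlgebra.coeff_smul, Finsupp.smul_apply, Finsupp.smul_apply,
        ← GroupVN.coeff_conjRing, GroupVN.conjRing_orbitSum hp]
  · rintro _ ⟨⟨p', hp', rfl⟩, hQp'⟩
    by_contra hne
    apply hQ.ne_zero
    -- With two distinct candidates, `Q = Q P P' = 0` by orthogonality of orbit sums.
    rw [← hQp', ← hQp, mul_assoc]
    exact (congrArg (Q * ·) (GroupVN.orbitSum_mul_orbitSum_of_ne hp hp' fun h => hne h.symm)).trans
      (mul_zero Q)
  · rintro _ ⟨p', hp', rfl⟩ hQp'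
    change Q * GroupVN.orbitSum p' = Q at hQp'
    have hproj := GroupVN.isStarProjection_orbitSum hp' hK
    have hD : (Nat.card (GroupVN.deltaPlus G) : ℂ) ≠ 0 := by exact_mod_cast Nat.card_pos.ne'
    have hHc : (Nat.card H : ℂ) ≠ 0 := by exact_mod_cast Nat.card_pos.ne'
    have hP1 := GroupVN.coeff_one_ne_zero hproj (GroupVN.orbitSum_ne_zero hp')
    have htr := GroupVN.ringTrace_eq_smul hK hH hQm hQi hp' hQp'
    refine ⟨hproj, GroupVN.isPrimitiveIdempotent_orbitSum hp', htr.trans ?_, htr.trans ?_⟩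
    · congr 1
      change _ = (((GroupVN.idealDim Q H * Nat.card (GroupVN.deltaPlus G)) /
        (Nat.card H * GroupVN.idealDim (GroupVN.orbitSum p') (GroupVN.deltaPlus G)) : ℚ) : ℂ)
      push_cast
      -- The dimensions are `|H| Q(1)` and `|Δ⁺| P(1)`, so the group orders cancel and `Q(1) / P(1)`
      -- remains.
      rw [GroupVN.idealDim_eq H (htop hQm) hQi, GroupVN.idealDim_eq (GroupVN.deltaPlus G)
        (htop (GroupVN.orbitSum_mem hp').1) (GroupVN.isIdempotentElem_orbitSum hp')]
      field_simp
    · congr 1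
      change _ = ((GroupVN.vnDim (GroupVN.leftImage Q) /
        GroupVN.vnDim (GroupVN.leftImage (GroupVN.orbitSum p')) : ℝ) : ℂ)
      rw [Complex.ofReal_div, GroupVN.vnDim_leftImage hQ.isProjectionIn.2,
        GroupVN.vnDim_leftImage hproj]
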